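/- **Model.** $R_t=\sigma_t\varepsilon_t$, $t\ge 1$, where the $\varepsilon_t$ are independent standard Gaussian and $\sigma_t>0$ is measurable with respect to $\sigma(R_1,\dots,R_{t-1})$. Put $f(t)=\sigma_t^2$, $Y_t=R_t^2$ and $\mathcal K(\theta',\theta)=-\tfrac12\{\log(\theta'/\theta)+1-\theta'/\theta\}$. For $\theta>0$, $\mathbb P_\theta$ and $\mathbb E_\theta$ refer to the model in which the $R_t$ are i.i.d. $\mathcal N(0,\theta)$. For a finite set $I$ of time points let $L_I(\theta)=\sum_{t\in I}\{-\tfrac12\log(2\pi\theta)-Y_t/(2\theta)\}$, with maximizer $\tilde\theta_I=|I|^{-1}\sum_{t\in I}Y_t$. **Procedure.** Let $K\ge1$, let $N_0<N_1<\dots<N_{K+1}$ be natural numbers, and let $t^\diamond>N_{K+1}$ be the point of estimation. Put $\mathcal I_k=[t^\diamond-N_k,t^\diamond[$, $\mathcal J_k=\mathcal I_k\setminus\mathcal I_{k-1}$, $\tilde\theta_k=\tilde\theta_{\mathcal I_k}$. For $I=[t',t''[$ and $\tau\in I$ let $$T_{I,\tau}=\max_{\theta'',\theta'>0}\{L_{[\tau,t''[}(\theta'')+L_{[t',\tau[}(\theta')\}-\max_{\theta>0}L_I(\theta),\qquad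 T_k=\max_{\tau\in\mathcal J_k}T_{\mathcal I_{k+1},\tau}.$$ Given critical values $\mathfrak z_1,\dots,\mathfrak z_K\ge 0$, let $\kappa_k=\max\{j\le k: T_l\le\mathfrak z_l,\ l=1,\dots,j\}$, $\hat\theta_k=\tilde\theta_{\kappa_k}$, and let $\hat\theta=\hat\theta_K$ be the final estimate. Let $r,\alpha>0$ and $\mathfrak r_r=2r\Gamma(r)$. The critical values satisfy the propagation condition: for some $\theta^*>0$, $$\mathbb E_{\theta^*}|N_k\mathcal K(\tilde\theta_k,\hat\theta_k)|^r\le\alpha\,\mathfrak r_r,\qquad k=1,\dots,K.$$ **Conditions.** (MD) There are constants $0<\mathfrak u_0\le\mathfrak u<1$ with $\mathfrak u_0\le N_{k-1}/N_k\le\mathfrak u$ for $k=1,\dots,K$. ($\Theta$) The parameter set $\Theta\subseteq(0,\infty)$ and the constant $\mathfrak a\ge1$ satisfy $\mathfrak a^{-2}\le\theta_0/\theta\le\mathfrak a^2$ for all $\theta_0,\theta\in\Theta$. Put $c_{\mathfrak u}=(1-\sqrt{\mathfrak u})^{-1}$, $\bar{\mathfrak z}_k=\max_{k\le l\le K}\mathfrak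 z_l$ and $\Delta_k(\theta)=\sum_{t\in\mathcal I_{k+1}}\mathcal K(f(t),\theta)$. **Theorem 4.6 ("Oracle" property).** Let $1\le k^*\le K$, and let $\theta\in\Theta$ and $\Delta$ be such that $\mathbb E\Delta_k(\theta)\le\Delta$ for $1\le k\le k^*$. Then the following expectation is finite and $$\mathbb E\log\Bigl(1+\frac{|N_{k^*}\mathcal K(\tilde\theta_{k^*},\hat\theta_{k^*})|^r}{\alpha\,\mathfrak r_r}\Bigr)\le 1+\Delta .$$ In addition, almost surely on the event that the estimates $\hat\theta_k$, $k^*\le k\le K$, lie in $\Theta$, $$N_{k^*}\,\mathcal K(\hat\theta_{k^*},\hat\theta)\le\mathfrak a^2c_{\mathfrak u}^2\,\bar{\mathfrak z}_{k^*}.$$ -/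

import Mathlib

open MeasureTheory ProbabilityTheory

namespace LCP

noncomputable section

/-! ### The conditionally heteroskedastic model -/

/-- The model `R_t = σ_t ε_t`, `t = 1, 2, …`: the innovations `ε_t` are independent standard
Gaussian, and the positive volatility `σ_t` is measurable with respect to
`𝓕_{t-1} = σ(R_1, …, R_{t-1})`.  (Values at the index `t = 0` play no role.) -/
structure IsVolatilityModel {Ω : Type*} [MeasurableSpace Ω] (P : Measure Ω)
    (ε σ R : ℕ → Ω → ℝ) : Prop where
  measurable_innovation : ∀ t, 1 ≤ t → Measurable (ε t)
  indep_innovation : iIndepFun (fun t : Set.Ici (1 : ℕ) => ε t) P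
  law_innovation : ∀ t, 1 ≤ t → P.map (ε t) = gaussianReal 0 1
  predictable : ∀ t, 1 ≤ t →
    Measurable[⨆ s ∈ Set.Ico 1 t, MeasurableSpace.comap (R s) inferInstance] (σ t)
  vol_pos : ∀ t, 1 ≤ t → ∀ ω, 0 < σ t ω
  return_eq : ∀ t, 1 ≤ t → ∀ ω, R t ω = σ t ω * ε t ω

/-- The parametric measure `P_θ`: the returns are i.i.d. `𝓝(0, θ)` (used for `θ > 0`). -/
def paramMeasure (θ : ℝ) : Measure (ℕ → ℝ) :=
  Measure.infinitePi fun _ : ℕ => gaussianReal 0 θ.toNNReal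

/-! ### Local maximum likelihood

Statistics are functions of the path `x : ℕ → ℝ` of returns; the squared returns are
`Y_t = x_t ^ 2`. -/

/-- Log-density `ℓ(y, θ)` of `𝓝(0, θ)` in terms of the squared observation `y`. -/
def logDensity (y θ : ℝ) : ℝ := -(1 / 2) * Real.log (2 * Real.pi * θ) - y / (2 * θ)

/-- The log-likelihood `L_I(θ) = ∑_{t ∈ I} ℓ(Y_t, θ)`. -/
def logLik (x : ℕ → ℝ) (I : Finset ℕ) (θ : ℝ) : ℝ := ∑ t ∈ I, logDensity (x t ^ 2) θ

/-- The local maximum likelihood estimate `θ̃_I = N_I⁻¹ ∑_{t ∈ I} Y_t`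
(see `logLik_le_logLik_mle`). -/
def mle (x : ℕ → ℝ) (I : Finset ℕ) : ℝ := (∑ t ∈ I, x t ^ 2) / (I.card : ℝ)

theorem logLik_eq (x : ℕ → ℝ) (I : Finset ℕ) (θ : ℝ) :
    logLik x I θ
      = -((I.card : ℝ) / 2) * Real.log (2 * Real.pi * θ) - (∑ t ∈ I, x t ^ 2) / (2 * θ) := by
  simp only [logLik, logDensity, Finset.sum_sub_distrib, Finset.sum_const, nsmul_eq_mul,
    Finset.sum_div]
  ring

/-- `θ̃_I` maximizes the log-likelihood over `θ > 0` (as soon as some return in `I` is nonzero,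
which holds almost surely). -/
theorem logLik_le_logLik_mle (x : ℕ → ℝ) (I : Finset ℕ) (hS : 0 < ∑ t ∈ I, x t ^ 2)
    (θ : ℝ) (hθ : 0 < θ) : logLik x I θ ≤ logLik x I (mle x I) := by
  have hI : 0 < (I.card : ℝ) := by
    rcases I.eq_empty_or_nonempty with h | h
    · simp [h] at hS
    · exact_mod_cast h.card_pos
  rw [logLik_eq, logLik_eq]
  have hm : 0 < mle x I := div_pos hS hI
  have hSm : ∑ t ∈ I, x t ^ 2 = I.card * mle x I := by
    unfold mle; field_simp
  rw [hSm, Real.log_mul (by positivity) hθ.ne', Real.log_mul (by positivity) hm.ne']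
  have h1 : (I.card : ℝ) * mle x I / (2 * mle x I) = I.card / 2 := by field_simp
  have h2 : (I.card : ℝ) * mle x I / (2 * θ) = I.card / 2 * (mle x I / θ) := by field_simp
  rw [h1, h2]
  have h3 := Real.log_le_sub_one_of_pos (div_pos hm hθ)
  rw [Real.log_div hm.ne' hθ.ne'] at h3
  nlinarith

/-- Kullback–Leibler information `𝒦(θ', θ)` of two centered normal laws with variances
`θ'` and `θ`. -/
def KL (θ' θ : ℝ) : ℝ := -(Real.log (θ' / θ) + 1 - θ' / θ) / 2

/-! ### The likelihood ratio test against a change point -/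

/-- The statistic `T_{I,τ}` for `I = [t', t''[`: the maximal log-likelihood with a change point
at `τ`, that is with parameter `p.1` on `[τ, t''[` and `p.2` on `[t', τ[`, minus the maximal
log-likelihood without a change point. -/
def changePointStat (x : ℕ → ℝ) (t' t'' τ : ℕ) : ℝ :=
  (⨆ p : Set.Ioi (0 : ℝ) × Set.Ioi (0 : ℝ),
      (logLik x (Finset.Ico τ t'') p.1 + logLik x (Finset.Ico t' τ) p.2))
    - ⨆ θ : Set.Ioi (0 : ℝ), logLik x (Finset.Ico t' t'') θ

/-! ### The multiscale procedure

`t₀` is the point of estimation, `N 0 < N 1 < … < N (K + 1)` are the interval lengths and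
`z 1, …, z K` the critical values. -/

/-- `𝓘_k = [t₀ - N_k, t₀[`. -/
def interval (t₀ : ℕ) (N : ℕ → ℕ) (k : ℕ) : Finset ℕ := Finset.Ico (t₀ - N k) t₀

/-- `𝒥_k = 𝓘_k \ 𝓘_{k-1}` for `k ≥ 1`. -/
def tested (t₀ : ℕ) (N : ℕ → ℕ) (k : ℕ) : Finset ℕ :=
  interval t₀ N k \ interval t₀ N (k - 1)

/-- `T_k`: the maximum over `τ ∈ 𝒥_k` of `T_{I,τ}` with testing interval `I = 𝓘_{k+1}`. -/
def testStat (x : ℕ → ℝ) (t₀ : ℕ) (N : ℕ → ℕ) (k : ℕ) : ℝ :=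
  ⨆ τ : tested t₀ N k, changePointStat x (t₀ - N (k + 1)) t₀ τ

open Classical in
/-- `κ_k`: index of the largest interval accepted after the first `k` steps,
`κ_k = max {j ≤ k : T_l ≤ z_l, l = 1, …, j}`. -/
def lastAccepted (x : ℕ → ℝ) (t₀ : ℕ) (N : ℕ → ℕ) (z : ℕ → ℝ) (k : ℕ) : ℕ :=
  Nat.findGreatest (fun j => ∀ l, 1 ≤ l → l ≤ j → testStat x t₀ N l ≤ z l) k

/-- `θ̃_k`. -/
def localEst (x : ℕ → ℝ) (t₀ : ℕ) (N : ℕ → ℕ) (k : ℕ) : ℝ := mle x (interval t₀ N k)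

/-- `θ̂_k = θ̃_{κ_k}`, the estimate after `k` steps; the final estimate is `θ̂ = θ̂_K`. -/
def adaptEst (x : ℕ → ℝ) (t₀ : ℕ) (N : ℕ → ℕ) (z : ℕ → ℝ) (k : ℕ) : ℝ :=
  localEst x t₀ N (lastAccepted x t₀ N z k)

/-- `𝔯_r = 2 r Γ(r)`. -/
def riskBound (r : ℝ) : ℝ := 2 * r * Real.Gamma r

/-- The propagation condition on the critical values:
`E_{θ*} |N_k 𝒦(θ̃_k, θ̂_k)|^r ≤ α 𝔯_r` for `k = 1, …, K`. -/
def Propagation (t₀ K : ℕ) (N : ℕ → ℕ) (z : ℕ → ℝ) (r α θstar : ℝ) : Prop :=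
  ∀ k, 1 ≤ k → k ≤ K →
    ∫⁻ x, ENNReal.ofReal (|(N k : ℝ) * KL (localEst x t₀ N k) (adaptEst x t₀ N z k)| ^ r)
        ∂(paramMeasure θstar)
      ≤ ENNReal.ofReal (α * riskBound r)

/-- Condition (MD): `0 < u₀ ≤ u < 1` and `u₀ ≤ N_{k-1} / N_k ≤ u`. -/
def ConditionMD (K : ℕ) (N : ℕ → ℕ) (u₀ u : ℝ) : Prop :=
  0 < u₀ ∧ u₀ ≤ u ∧ u < 1 ∧
    ∀ k, 1 ≤ k → k ≤ K → u₀ ≤ (N (k - 1) : ℝ) / N k ∧ (N (k - 1) : ℝ) / N k ≤ u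

/-- Condition (Θ) on the parameter set `Θ ⊆ (0, ∞)`: `a ≥ 1` and `a⁻² ≤ θ₀ / θ ≤ a²`. -/
def ConditionTheta (Θ : Set ℝ) (a : ℝ) : Prop :=
  Θ ⊆ Set.Ioi 0 ∧ 1 ≤ a ∧ ∀ θ₀ ∈ Θ, ∀ θ ∈ Θ, (a ^ 2)⁻¹ ≤ θ₀ / θ ∧ θ₀ / θ ≤ a ^ 2

/-- The modeling bias `Δ_k(θ) = ∑_{t ∈ 𝓘_{k+1}} 𝒦(f(t), θ)`, where `f(t) = σ_t²`;
here `s t` is the value of `σ_t`. -/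
def modelingBias (s : ℕ → ℝ) (t₀ : ℕ) (N : ℕ → ℕ) (k : ℕ) (θ : ℝ) : ℝ :=
  ∑ t ∈ interval t₀ N (k + 1), KL (s t ^ 2) θ

/-- `z̄_k = max_{k ≤ l ≤ K} z_l`. -/
def maxCrit (K : ℕ) (z : ℕ → ℝ) (k : ℕ) : ℝ := sSup (z '' Set.Icc k K)

/-- `c_u = (1 - √u)⁻¹`. -/
def cConst (u : ℝ) : ℝ := (1 - Real.sqrt u)⁻¹

end

end LCP

open LCP

/-!
Oracle property of the multiscale local change point procedure.

**Risk bound.** Let `X` be the normalized loss of the adaptive estimate after `k*` steps and `Z` the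
likelihood ratio of the i.i.d. `𝓝(0, θ)` model with respect to the volatility model on `𝓘_{k*+1}`,
the only part of the path that `X` sees.  From `log y ≤ y - 1`,
`log (1 + X) ≤ (1 + X) Z - 1 - log Z`.  By change of measure the expectation of `(1 + X) Z` is
`E_θ (1 + X)` (`IsVolatilityModel.lintegral_splice_mul_likRatio`).  It is at most `2`: the loss is
invariant under rescaling of the path, hence has the same law under `P_θ` as under `P_{θ*}`, where
the propagation condition applies (`lintegral_normLoss_le`).  The expectation of `-log Z` is the
expected modeling bias, as `σ_t` is independent of `ε_t` and `E ε_t² = 1`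
(`IsVolatilityModel.integral_neg_log_likRatio`).  Altogether the bound is `2 - 1 + Δ`.

**Stability.** If the procedure accepts at most `k*` steps, the estimates after `k*` and after `K`
steps coincide.  Otherwise both are local estimates `θ̃_{k*}` and `θ̃_κ`.  The likelihood ratio
statistic is a sum of two weighted Kullback–Leibler divergences (`changePointStat_eq`), and the
candidate `τ = t₀ - N_l` is tested at step `l`, so acceptance gives
`N_l 𝒦(θ̃_l, θ̃_{l+1}) ≤ z_l` (`length_mul_KL_le_testStat`).  The steps are chained with a triangle
inequality for `√𝒦` up to the factor `a` (`sqrt_KL_le_sum`), and the ratios `N_{k*} / N_l ≤ u^{l-k*}`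
make the sum geometric.
-/

namespace LCP

/-! ### Kullback–Leibler information of centered normal laws -/

theorem KL_self {θ : ℝ} (h : θ ≠ 0) : KL θ θ = 0 := by
  simp [KL, div_self h]

theorem KL_nonneg {θ' θ : ℝ} (h' : 0 < θ') (h : 0 < θ) : 0 ≤ KL θ' θ := by
  have := Real.log_le_sub_one_of_pos (div_pos h' h)
  unfold KL; linarith

theorem KL_mul_left {c : ℝ} (hc : c ≠ 0) (θ' θ : ℝ) : KL (c * θ') (c * θ) = KL θ' θ := by
  simp [KL, mul_div_mul_left _ _ hc]

/-- In the logarithmic parametrization, `𝒦` is half of `e^δ - 1 - δ` at the increment `δ`. -/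
theorem KL_eq_exp {θ' θ : ℝ} (h' : 0 < θ') (h : 0 < θ) :
    KL θ' θ = (Real.exp (Real.log θ' - Real.log θ) - 1 - (Real.log θ' - Real.log θ)) / 2 := by
  rw [← Real.log_div h'.ne' h.ne', Real.exp_log (div_pos h' h), KL]
  ring

theorem monotone_exp_mul_sub_one_sub_sq :
    Monotone fun t : ℝ => Real.exp t * (t - 1) + 1 - t ^ 2 / 2 := by
  have hd : ∀ t : ℝ, HasDerivAt (fun t : ℝ => Real.exp t * (t - 1) + 1 - t ^ 2 / 2)
      (t * (Real.exp t - 1)) t := by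
    intro t
    have h1 := ((Real.hasDerivAt_exp t).mul ((hasDerivAt_id t).sub_const 1)).add_const 1
    have h2 := ((hasDerivAt_id t).pow 2).div_const 2
    refine (h1.sub h2).congr_deriv ?_
    simp only [id_eq, Nat.cast_ofNat, Nat.add_one_sub_one, pow_one]
    ring
  refine monotone_of_deriv_nonneg (fun t => (hd t).differentiableAt) fun t => ?_
  rw [(hd t).deriv]
  rcases le_total 0 t with h | h
  · exact mul_nonneg h (by linarith [Real.one_le_exp h])
  · exact mul_nonneg_of_nonpos_of_nonpos h (by linarith [Real.exp_le_one_iff.2 h])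

theorem exp_sub_one_sub_le_of_nonneg {d : ℝ} (h : 0 ≤ d) :
    Real.exp d - 1 - d ≤ Real.exp d * (d ^ 2 / 2) := by
  have h1 := monotone_exp_mul_sub_one_sub_sq (neg_nonpos.2 h)
  simp only [Real.exp_zero] at h1
  have h2 : Real.exp d * Real.exp (-d) = 1 := by rw [← Real.exp_add]; simp
  have h3 : Real.exp (-d) * (-d - 1) + 1 - d ^ 2 / 2 ≤ 0 := by nlinarith
  have h4 := mul_nonpos_of_nonneg_of_nonpos (Real.exp_pos d).le h3
  have h5 : Real.exp d * (Real.exp (-d) * (-d - 1) + 1 - d ^ 2 / 2)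
      = -d - 1 + Real.exp d - Real.exp d * (d ^ 2 / 2) := by
    linear_combination (-d - 1) * h2
  linarith

theorem le_exp_sub_one_sub_of_nonneg {d : ℝ} (h : 0 ≤ d) :
    d ^ 2 / 2 ≤ Real.exp d - 1 - d := by
  linarith [Real.quadratic_le_exp_of_nonneg h]

theorem exp_sub_one_sub_le_of_nonpos {d : ℝ} (h : d ≤ 0) :
    Real.exp d - 1 - d ≤ d ^ 2 / 2 := by
  have h1 := Real.quadratic_le_exp_of_nonneg (neg_nonneg.2 h)
  have h2 : Real.exp d * Real.exp (-d) = 1 := by rw [← Real.exp_add]; simp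
  have h3 : Real.exp d * (1 + -d + (-d) ^ 2 / 2) ≤ 1 := by
    exact (mul_le_mul_of_nonneg_left h1 (Real.exp_pos d).le).trans h2.le
  have h4 : (1 + -d + (-d) ^ 2 / 2) * (1 + d + d ^ 2 / 2) = 1 + d ^ 4 / 4 := by ring
  have h5 : 0 < 1 + -d + (-d) ^ 2 / 2 := by nlinarith
  by_contra hcon
  push Not at hcon
  have : (1 + -d + (-d) ^ 2 / 2) * (1 + d + d ^ 2 / 2)
      < (1 + -d + (-d) ^ 2 / 2) * Real.exp d := by
    gcongr; linarith
  nlinarith [sq_nonneg (d ^ 2)]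

theorem le_exp_sub_one_sub_of_nonpos {d : ℝ} (h : d ≤ 0) :
    Real.exp d * (d ^ 2 / 2) ≤ Real.exp d - 1 - d := by
  have h1 := monotone_exp_mul_sub_one_sub_sq (neg_nonneg.2 h)
  simp only [Real.exp_zero] at h1
  have h2 : Real.exp d * Real.exp (-d) = 1 := by rw [← Real.exp_add]; simp
  have h3 : 0 ≤ Real.exp (-d) * (-d - 1) + 1 - d ^ 2 / 2 := by nlinarith
  have h4 := mul_nonneg (Real.exp_pos d).le h3
  have h5 : Real.exp d * (Real.exp (-d) * (-d - 1) + 1 - d ^ 2 / 2)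
      = -d - 1 + Real.exp d - Real.exp d * (d ^ 2 / 2) := by
    linear_combination (-d - 1) * h2
  linarith

/-- Along a path of variances in a set with ratios in `[a⁻², a²]`, the square root of `𝒦`
satisfies a triangle inequality up to the factor `a`.  The constant is `a`, not `a²`, because only
the increments of `log θ` with the sign of the total increment are needed: for positive increments
the curvature bound `a²` is spent on the total, for negative ones on the summands. -/
theorem sqrt_KL_le_sum {Θ : Set ℝ} {a : ℝ} (hΘ : ConditionTheta Θ a) (q : ℕ → ℝ) (m n : ℕ)
    (hmn : m ≤ n) (hq : ∀ l, m ≤ l → l ≤ n → q l ∈ Θ) :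
    Real.sqrt (KL (q m) (q n)) ≤ a * ∑ l ∈ Finset.Ico m n, Real.sqrt (KL (q l) (q (l + 1))) := by
  obtain ⟨hpos, ha, hrat⟩ := hΘ
  have ha0 : 0 < a := by linarith
  set D : ℕ → ℝ := fun l => Real.log (q l) - Real.log (q (l + 1)) with hD
  have hqm := hq m le_rfl hmn
  have hqn := hq n hmn le_rfl
  have hsum : Real.log (q m) - Real.log (q n) = ∑ l ∈ Finset.Ico m n, D l := by
    rw [← neg_sub, ← Finset.sum_Ico_sub (fun l => Real.log (q l)) hmn, ← Finset.sum_neg_distrib]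
    exact Finset.sum_congr rfl fun l _ => (neg_sub _ _)
  have hexp : ∀ x ∈ Θ, ∀ y ∈ Θ, Real.exp (Real.log x - Real.log y) = x / y := by
    intro x hx y hy
    rw [← Real.log_div (hpos hx).ne' (hpos hy).ne', Real.exp_log (div_pos (hpos hx) (hpos hy))]
  have h2 : (0 : ℝ) ≤ 1 / 2 := by norm_num
  rcases le_total 0 (Real.log (q m) - Real.log (q n)) with hs | hs
  · have h1 : Real.sqrt (KL (q m) (q n)) ≤ a * (Real.log (q m) - Real.log (q n)) / 2 := by
      rw [KL_eq_exp (hpos hqm) (hpos hqn)]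
      refine Real.sqrt_le_iff.2 ⟨by positivity, ?_⟩
      have h3 := exp_sub_one_sub_le_of_nonneg hs
      have h4 : Real.exp (Real.log (q m) - Real.log (q n)) ≤ a ^ 2 := by
        rw [hexp _ hqm _ hqn]; exact (hrat _ hqm _ hqn).2
      have h5 := mul_le_mul_of_nonneg_right h4
        (show 0 ≤ (Real.log (q m) - Real.log (q n)) ^ 2 / 2 by positivity)
      linarith
    have h6 : ∑ l ∈ Finset.Ico m n, D l / 2
        ≤ ∑ l ∈ Finset.Ico m n, Real.sqrt (KL (q l) (q (l + 1))) := by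
      refine Finset.sum_le_sum fun l hl => ?_
      rw [Finset.mem_Ico] at hl
      rcases le_total 0 (D l) with hl0 | hl0
      · refine Real.le_sqrt_of_sq_le ?_
        rw [KL_eq_exp (hpos (hq l hl.1 hl.2.le)) (hpos (hq (l + 1) (by omega) (by omega)))]
        have := le_exp_sub_one_sub_of_nonneg hl0
        simp only [hD] at this ⊢
        linarith
      · exact (by linarith : D l / 2 ≤ 0).trans (Real.sqrt_nonneg _)
    calc _ ≤ _ := h1
      _ = a * ∑ l ∈ Finset.Ico m n, D l / 2 := by rw [hsum, ← Finset.sum_div]; ring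
      _ ≤ _ := by gcongr
  · have h1 : Real.sqrt (KL (q m) (q n)) ≤ -(Real.log (q m) - Real.log (q n)) / 2 := by
      rw [KL_eq_exp (hpos hqm) (hpos hqn)]
      refine Real.sqrt_le_iff.2 ⟨by linarith, ?_⟩
      have h3 := exp_sub_one_sub_le_of_nonpos hs
      linarith
    have h6 : ∑ l ∈ Finset.Ico m n, -D l / 2
        ≤ ∑ l ∈ Finset.Ico m n, a * Real.sqrt (KL (q l) (q (l + 1))) := by
      refine Finset.sum_le_sum fun l hl => ?_
      rw [Finset.mem_Ico] at hl
      have hl1 := hq l hl.1 hl.2.le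
      have hl2 := hq (l + 1) (by omega) (by omega)
      rcases le_total (D l) 0 with hl0 | hl0
      · rw [← div_le_iff₀' ha0]
        refine Real.le_sqrt_of_sq_le ?_
        rw [KL_eq_exp (hpos hl1) (hpos hl2)]
        have h7 := le_exp_sub_one_sub_of_nonpos hl0
        have h8 : (a ^ 2)⁻¹ ≤ Real.exp (D l) := by
          simp only [hD]
          rw [hexp _ hl1 _ hl2]; exact (hrat _ hl1 _ hl2).1
        have h9 := mul_le_mul_of_nonneg_right h8 (show 0 ≤ D l ^ 2 / 2 by positivity)
        have h10 : (-D l / 2 / a) ^ 2 = (a ^ 2)⁻¹ * (D l ^ 2 / 2) / 2 := by field_simp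
        rw [h10]
        change _ ≤ (Real.exp (D l) - 1 - D l) / 2
        linarith
      · exact (by linarith : -D l / 2 ≤ 0).trans (by positivity)
    calc _ ≤ _ := h1
      _ = ∑ l ∈ Finset.Ico m n, -D l / 2 := by
        rw [hsum, ← Finset.sum_div, Finset.sum_neg_distrib]
      _ ≤ _ := h6
      _ = _ := by rw [Finset.mul_sum]

/-! ### The change point statistic in terms of the local estimates -/

theorem sum_sq_pos {x : ℕ → ℝ} {I : Finset ℕ} (hI : I.Nonempty) (hx : ∀ t ∈ I, x t ≠ 0) :
    0 < ∑ t ∈ I, x t ^ 2 :=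
  Finset.sum_pos (fun t ht => by have := hx t ht; positivity) hI

theorem mle_pos {x : ℕ → ℝ} {I : Finset ℕ} (hI : I.Nonempty) (hx : ∀ t ∈ I, x t ≠ 0) :
    0 < mle x I :=
  div_pos (sum_sq_pos hI hx) (by exact_mod_cast hI.card_pos)

theorem card_mul_mle {x : ℕ → ℝ} {I : Finset ℕ} (hI : I.Nonempty) :
    (I.card : ℝ) * mle x I = ∑ t ∈ I, x t ^ 2 := by
  have : (I.card : ℝ) ≠ 0 := by exact_mod_cast hI.card_pos.ne'
  unfold mle; field_simp

theorem logLik_mle {x : ℕ → ℝ} {I : Finset ℕ} (hI : I.Nonempty) (hx : ∀ t ∈ I, x t ≠ 0) :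
    logLik x I (mle x I)
      = -((I.card : ℝ) / 2) * (Real.log (2 * Real.pi) + Real.log (mle x I)) - I.card / 2 := by
  have hm := mle_pos hI hx
  rw [logLik_eq, ← card_mul_mle hI, Real.log_mul (by positivity) hm.ne']
  congr 1
  field_simp

theorem iSup_logLik {x : ℕ → ℝ} {I : Finset ℕ} (hI : I.Nonempty) (hx : ∀ t ∈ I, x t ≠ 0) :
    ⨆ θ : Set.Ioi (0 : ℝ), logLik x I θ = logLik x I (mle x I) := by
  have hle : ∀ θ : Set.Ioi (0 : ℝ), logLik x I θ ≤ logLik x I (mle x I) := fun θ =>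
    logLik_le_logLik_mle x I (sum_sq_pos hI hx) θ θ.2
  have : Nonempty (Set.Ioi (0 : ℝ)) := ⟨⟨1, Set.mem_Ioi.2 one_pos⟩⟩
  exact le_antisymm (ciSup_le hle) (le_ciSup (f := fun θ : Set.Ioi (0 : ℝ) => logLik x I θ)
    ⟨_, Set.forall_mem_range.2 hle⟩ ⟨_, mle_pos hI hx⟩)

theorem iSup_logLik_add {x : ℕ → ℝ} {I J : Finset ℕ} (hI : I.Nonempty) (hx : ∀ t ∈ I, x t ≠ 0)
    (hJ : J.Nonempty) (hxJ : ∀ t ∈ J, x t ≠ 0) :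
    ⨆ p : Set.Ioi (0 : ℝ) × Set.Ioi (0 : ℝ), (logLik x I p.1 + logLik x J p.2)
      = logLik x I (mle x I) + logLik x J (mle x J) := by
  have hle : ∀ p : Set.Ioi (0 : ℝ) × Set.Ioi (0 : ℝ), logLik x I p.1 + logLik x J p.2
      ≤ logLik x I (mle x I) + logLik x J (mle x J) := fun p =>
    add_le_add (logLik_le_logLik_mle x I (sum_sq_pos hI hx) p.1 p.1.2)
      (logLik_le_logLik_mle x J (sum_sq_pos hJ hxJ) p.2 p.2.2)
  have : Nonempty (Set.Ioi (0 : ℝ)) := ⟨⟨1, Set.mem_Ioi.2 one_pos⟩⟩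
  exact le_antisymm (ciSup_le hle)
    (le_ciSup (f := fun p : Set.Ioi (0 : ℝ) × Set.Ioi (0 : ℝ) => logLik x I p.1 + logLik x J p.2)
      ⟨_, Set.forall_mem_range.2 hle⟩ (⟨_, mle_pos hI hx⟩, ⟨_, mle_pos hJ hxJ⟩))

/-- The likelihood ratio statistic is a weighted sum of divergences of the two one-sided estimates
from the estimate on the whole interval.  The linear parts of `𝒦` cancel because the whole
estimate is the weighted mean of the one-sided ones. -/
theorem changePointStat_eq {x : ℕ → ℝ} {t' t'' τ : ℕ} (h1 : t' < τ) (h2 : τ < t'')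
    (hx : ∀ t ∈ Finset.Ico t' t'', x t ≠ 0) :
    changePointStat x t' t'' τ
      = ((Finset.Ico τ t'').card : ℝ) * KL (mle x (Finset.Ico τ t'')) (mle x (Finset.Ico t' t''))
        + ((Finset.Ico t' τ).card : ℝ)
          * KL (mle x (Finset.Ico t' τ)) (mle x (Finset.Ico t' t'')) := by
  have n1 : (Finset.Ico τ t'').Nonempty := Finset.nonempty_Ico.2 h2
  have n2 : (Finset.Ico t' τ).Nonempty := Finset.nonempty_Ico.2 h1
  have n3 : (Finset.Ico t' t'').Nonempty := Finset.nonempty_Ico.2 (h1.trans h2)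
  have x1 : ∀ t ∈ Finset.Ico τ t'', x t ≠ 0 := fun t ht =>
    hx t (Finset.Ico_subset_Ico_left h1.le ht)
  have x2 : ∀ t ∈ Finset.Ico t' τ, x t ≠ 0 := fun t ht =>
    hx t (Finset.Ico_subset_Ico_right h2.le ht)
  have p1 := mle_pos n1 x1
  have p2 := mle_pos n2 x2
  have p3 := mle_pos n3 hx
  have hS : ((Finset.Ico t' t'').card : ℝ) * mle x (Finset.Ico t' t'')
      = ((Finset.Ico τ t'').card : ℝ) * mle x (Finset.Ico τ t'')
        + ((Finset.Ico t' τ).card : ℝ) * mle x (Finset.Ico t' τ) := by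
    rw [card_mul_mle n1, card_mul_mle n2, card_mul_mle n3, add_comm,
      Finset.sum_Ico_consecutive _ h1.le h2.le]
  have hc : ((Finset.Ico t' t'').card : ℝ)
      = (Finset.Ico τ t'').card + (Finset.Ico t' τ).card := by
    rw [← Nat.cast_add]
    congr 1
    simp only [Nat.card_Ico]
    omega
  rw [changePointStat, iSup_logLik_add n1 x1 n2 x2, iSup_logLik n3 hx, logLik_mle n1 x1,
    logLik_mle n2 x2, logLik_mle n3 hx, KL, KL, Real.log_div p1.ne' p3.ne',
    Real.log_div p2.ne' p3.ne']
  have hS' : ((Finset.Ico t' t'').card : ℝ)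
      = ((Finset.Ico τ t'').card : ℝ) * (mle x (Finset.Ico τ t'') / mle x (Finset.Ico t' t''))
        + ((Finset.Ico t' τ).card : ℝ)
          * (mle x (Finset.Ico t' τ) / mle x (Finset.Ico t' t'')) := by
    field_simp
    linarith
  rw [hc] at hS' ⊢
  linear_combination (1 / 2) * hS'

/-! ### Scale invariance and locality of the procedure -/

theorem mle_const_mul (c : ℝ) (x : ℕ → ℝ) (I : Finset ℕ) :
    mle (fun t => c * x t) I = c ^ 2 * mle x I := by
  simp only [mle, mul_pow, ← Finset.mul_sum, mul_div_assoc]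

theorem changePointStat_const_mul {c : ℝ} (hc : c ≠ 0) {x : ℕ → ℝ} {t' t'' τ : ℕ} (h1 : t' < τ)
    (h2 : τ < t'') (hx : ∀ t ∈ Finset.Ico t' t'', x t ≠ 0) :
    changePointStat (fun t => c * x t) t' t'' τ = changePointStat x t' t'' τ := by
  rw [changePointStat_eq h1 h2 hx,
    changePointStat_eq h1 h2 fun t ht => mul_ne_zero hc (hx t ht)]
  simp only [mle_const_mul, KL_mul_left (pow_ne_zero 2 hc)]

theorem mem_tested {t₀ : ℕ} {N : ℕ → ℕ} {k τ : ℕ} :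
    τ ∈ tested t₀ N k ↔ t₀ - N k ≤ τ ∧ τ < t₀ - N (k - 1) := by
  simp only [tested, interval, Finset.mem_sdiff, Finset.mem_Ico]
  omega

theorem testStat_const_mul {c : ℝ} (hc : c ≠ 0) {x : ℕ → ℝ} {t₀ : ℕ} {N : ℕ → ℕ} {k : ℕ}
    (hN : N k < N (k + 1)) (ht₀ : N (k + 1) < t₀)
    (hx : ∀ t ∈ interval t₀ N (k + 1), x t ≠ 0) :
    testStat (fun t => c * x t) t₀ N k = testStat x t₀ N k := by
  refine iSup_congr fun τ => changePointStat_const_mul hc ?_ ?_ hx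
  · have := mem_tested.1 τ.2; omega
  · have := mem_tested.1 τ.2; omega

/-- `κ_k` is the largest number of steps `j ≤ k` all of whose tests accept. -/
theorem isGreatest_lastAccepted (x : ℕ → ℝ) (t₀ : ℕ) (N : ℕ → ℕ) (z : ℕ → ℝ) (k : ℕ) :
    IsGreatest {j | j ≤ k ∧ ∀ l, 1 ≤ l → l ≤ j → testStat x t₀ N l ≤ z l}
      (lastAccepted x t₀ N z k) := by
  -- The decidability instance has to be a variable, as the one in `lastAccepted` is classical.
  have key : ∀ (p : ℕ → Prop) (_ : DecidablePred p), p 0 →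
      IsGreatest {j | j ≤ k ∧ p j} (Nat.findGreatest p k) := fun p _ h0 =>
    ⟨⟨Nat.findGreatest_le k, Nat.findGreatest_spec (Nat.zero_le k) h0⟩,
      fun j hj => Nat.le_findGreatest hj.1 hj.2⟩
  exact key _ _ fun l h1 h2 => by omega

theorem lastAccepted_le {x : ℕ → ℝ} {t₀ : ℕ} {N : ℕ → ℕ} {z : ℕ → ℝ} {k : ℕ} :
    lastAccepted x t₀ N z k ≤ k :=
  (isGreatest_lastAccepted x t₀ N z k).1.1

theorem lastAccepted_spec {x : ℕ → ℝ} {t₀ : ℕ} {N : ℕ → ℕ} {z : ℕ → ℝ} {k l : ℕ} (hl1 : 1 ≤ l)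
    (hl : l ≤ lastAccepted x t₀ N z k) : testStat x t₀ N l ≤ z l :=
  (isGreatest_lastAccepted x t₀ N z k).1.2 l hl1 hl

theorem le_lastAccepted {x : ℕ → ℝ} {t₀ : ℕ} {N : ℕ → ℕ} {z : ℕ → ℝ} {j k : ℕ} (hjk : j ≤ k)
    (h : ∀ l, 1 ≤ l → l ≤ j → testStat x t₀ N l ≤ z l) : j ≤ lastAccepted x t₀ N z k :=
  (isGreatest_lastAccepted x t₀ N z k).2 ⟨hjk, h⟩

theorem lastAccepted_congr {x y : ℕ → ℝ} {t₀ : ℕ} {N : ℕ → ℕ} {z : ℕ → ℝ} {k : ℕ}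
    (h : ∀ l, 1 ≤ l → l ≤ k → testStat x t₀ N l = testStat y t₀ N l) :
    lastAccepted x t₀ N z k = lastAccepted y t₀ N z k := by
  have aux : ∀ {x y : ℕ → ℝ}, (∀ l, 1 ≤ l → l ≤ k → testStat x t₀ N l = testStat y t₀ N l) →
      lastAccepted x t₀ N z k ≤ lastAccepted y t₀ N z k := by
    intro x y h
    refine le_lastAccepted lastAccepted_le fun l hl1 hl2 => ?_
    rw [← h l hl1 (hl2.trans lastAccepted_le)]
    exact lastAccepted_spec hl1 hl2
  exact le_antisymm (aux h) (aux fun l h1 h2 => (h l h1 h2).symm)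

theorem monotoneOn_lengths {K : ℕ} {N : ℕ → ℕ} (hN : ∀ k, k ≤ K → N k < N (k + 1)) {i j : ℕ}
    (hij : i ≤ j) (hj : j ≤ K + 1) : N i ≤ N j := by
  induction j, hij using Nat.le_induction with
  | base => exact le_rfl
  | succ j hij ih => exact (ih (by omega)).trans (hN j (by omega)).le

theorem interval_subset {t₀ : ℕ} {N : ℕ → ℕ} {i j : ℕ} (h : N i ≤ N j) :
    interval t₀ N i ⊆ interval t₀ N j :=
  Finset.Ico_subset_Ico_left (by omega)

theorem mle_congr {x y : ℕ → ℝ} {I : Finset ℕ} (h : ∀ t ∈ I, x t = y t) : mle x I = mle y I := by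
  simp only [mle]
  rw [Finset.sum_congr rfl fun t ht => by rw [h t ht]]

theorem logLik_congr {x y : ℕ → ℝ} {I : Finset ℕ} (h : ∀ t ∈ I, x t = y t) (θ : ℝ) :
    logLik x I θ = logLik y I θ :=
  Finset.sum_congr rfl fun t ht => by rw [h t ht]

theorem testStat_congr {x y : ℕ → ℝ} {t₀ : ℕ} {N : ℕ → ℕ} {k : ℕ} (hN : N k ≤ N (k + 1))
    (h : ∀ t ∈ interval t₀ N (k + 1), x t = y t) : testStat x t₀ N k = testStat y t₀ N k := by
  refine iSup_congr fun τ => ?_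
  have hτ := mem_tested.1 τ.2
  have e1 : ∀ t ∈ Finset.Ico (τ : ℕ) t₀, x t = y t := fun t ht =>
    h t (Finset.Ico_subset_Ico_left (by omega) ht)
  have e2 : ∀ t ∈ Finset.Ico (t₀ - N (k + 1)) τ, x t = y t := fun t ht =>
    h t (Finset.Ico_subset_Ico_right (by omega) ht)
  simp only [changePointStat, logLik_congr e1, logLik_congr e2,
    logLik_congr (I := Finset.Ico (t₀ - N (k + 1)) t₀) h]

noncomputable section

/-- The normalized loss `|N_k 𝒦(θ̃_k, θ̂_k)|^r / (α 𝔯_r)` of the adaptive estimate after `k` steps,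
as a function of the path of returns. -/
def normLoss (t₀ : ℕ) (N : ℕ → ℕ) (z : ℕ → ℝ) (r α : ℝ) (k : ℕ) (x : ℕ → ℝ) : ℝ :=
  |(N k : ℝ) * KL (localEst x t₀ N k) (adaptEst x t₀ N z k)| ^ r / (α * riskBound r)

end

theorem normLoss_congr {K : ℕ} {x y : ℕ → ℝ} {t₀ : ℕ} {N : ℕ → ℕ} {z : ℕ → ℝ} {r α : ℝ} {k : ℕ}
    (hN : ∀ k, k ≤ K → N k < N (k + 1)) (hk : k ≤ K)
    (h : ∀ t ∈ interval t₀ N (k + 1), x t = y t) :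
    normLoss t₀ N z r α k x = normLoss t₀ N z r α k y := by
  have hl : ∀ l ≤ k, localEst x t₀ N l = localEst y t₀ N l := fun l hl =>
    mle_congr fun t ht => h t (interval_subset (monotoneOn_lengths hN (by omega) (by omega)) ht)
  have hκ : lastAccepted x t₀ N z k = lastAccepted y t₀ N z k :=
    lastAccepted_congr fun l _ hlk => testStat_congr (hN l (by omega)).le fun t ht =>
      h t (interval_subset (monotoneOn_lengths hN (by omega) (by omega)) ht)
  simp only [normLoss, adaptEst]
  rw [hl k le_rfl, hκ, hl _ lastAccepted_le]

/-- The loss is a pivotal quantity. -/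
theorem normLoss_const_mul {K : ℕ} {c : ℝ} (hc : c ≠ 0) {x : ℕ → ℝ} {t₀ : ℕ} {N : ℕ → ℕ}
    {z : ℕ → ℝ} {r α : ℝ} {k : ℕ} (hN : ∀ k, k ≤ K → N k < N (k + 1)) (ht₀ : N (K + 1) < t₀)
    (hk : k ≤ K) (hx : ∀ t, x t ≠ 0) :
    normLoss t₀ N z r α k (fun t => c * x t) = normLoss t₀ N z r α k x := by
  have hκ : lastAccepted (fun t => c * x t) t₀ N z k = lastAccepted x t₀ N z k :=
    lastAccepted_congr fun l _ hlk => testStat_const_mul hc (hN l (by omega))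
      ((monotoneOn_lengths hN (by omega) le_rfl).trans_lt ht₀) fun t _ => hx t
  simp only [normLoss, adaptEst, localEst, hκ, mle_const_mul, KL_mul_left (pow_ne_zero 2 hc)]

/-! ### Stability of the accepted estimates -/

theorem lastAccepted_of_le {x : ℕ → ℝ} {t₀ : ℕ} {N : ℕ → ℕ} {z : ℕ → ℝ} {k K : ℕ} (hk : k ≤ K) :
    lastAccepted x t₀ N z k = min k (lastAccepted x t₀ N z K) := by
  apply le_antisymm
  · exact le_min lastAccepted_le
      (le_lastAccepted (lastAccepted_le.trans hk) fun l h1 h2 => lastAccepted_spec h1 h2)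
  · exact le_lastAccepted (min_le_left _ _) fun l h1 h2 =>
      lastAccepted_spec h1 (h2.trans (min_le_right _ _))

/-- Testing for a change at the left end of `𝓘_k` within `𝓘_{k+1}` compares consecutive
estimates. -/
theorem length_mul_KL_le_testStat {x : ℕ → ℝ} {t₀ : ℕ} {N : ℕ → ℕ} {k : ℕ} (h0 : 0 < N (k - 1))
    (h1 : N (k - 1) < N k) (h2 : N k < N (k + 1)) (ht₀ : N (k + 1) < t₀)
    (hx : ∀ t ∈ interval t₀ N (k + 1), x t ≠ 0) :
    (N k : ℝ) * KL (localEst x t₀ N k) (localEst x t₀ N (k + 1)) ≤ testStat x t₀ N k := by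
  have hmem : t₀ - N k ∈ tested t₀ N k := mem_tested.2 (by omega)
  have hle : changePointStat x (t₀ - N (k + 1)) t₀ (t₀ - N k) ≤ testStat x t₀ N k :=
    le_ciSup (f := fun τ : tested t₀ N k => changePointStat x (t₀ - N (k + 1)) t₀ τ)
      (Set.finite_range _).bddAbove ⟨_, hmem⟩
  refine le_trans ?_ hle
  rw [changePointStat_eq (by omega) (by omega) hx]
  have hcard : (Finset.Ico (t₀ - N k) t₀).card = N k := by rw [Nat.card_Ico]; omega
  rw [hcard]
  have hx2 : ∀ t ∈ Finset.Ico (t₀ - N (k + 1)) (t₀ - N k), x t ≠ 0 := fun t ht =>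
    hx t (Finset.Ico_subset_Ico_right (by omega) ht)
  have hnn := KL_nonneg (mle_pos (Finset.nonempty_Ico.2 (by omega)) hx2)
    (mle_pos (Finset.nonempty_Ico.2 (by omega)) hx)
  simp only [localEst, interval]
  exact le_add_of_nonneg_right (by positivity)

theorem lengths_le_pow_mul {K : ℕ} {N : ℕ → ℕ} {u₀ u : ℝ} (hMD : ConditionMD K N u₀ u) {k j : ℕ}
    (hkj : k + j ≤ K) : (N k : ℝ) ≤ u ^ j * N (k + j) := by
  obtain ⟨hu0, huu, -, h⟩ := hMD
  induction j with
  | zero => simp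
  | succ j ih =>
    obtain ⟨h1, h2⟩ := h (k + (j + 1)) (by omega) hkj
    have hu : 0 < u := by linarith
    have hpos : (0 : ℝ) < N (k + (j + 1)) := by
      rcases Nat.eq_zero_or_pos (N (k + (j + 1))) with h0 | h0
      · rw [h0] at h1; simp at h1; linarith
      · exact_mod_cast h0
    rw [div_le_iff₀ hpos, show k + (j + 1) - 1 = k + j by omega] at h2
    calc (N k : ℝ) ≤ u ^ j * N (k + j) := ih (by omega)
      _ ≤ u ^ j * (u * N (k + (j + 1))) := by gcongr
      _ = _ := by ring

/-- Once accepted up to step `k`, the estimate can only move by a controlled amount: consecutive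
accepted estimates are within the critical values of each other, and the lengths grow
geometrically. -/
theorem length_mul_KL_adaptEst_le {x : ℕ → ℝ} {t₀ K : ℕ} {N : ℕ → ℕ} {u₀ u a : ℝ} {Θ : Set ℝ}
    {z : ℕ → ℝ} {k : ℕ} (hN : ∀ k, k ≤ K → N k < N (k + 1)) (ht₀ : N (K + 1) < t₀)
    (hMD : ConditionMD K N u₀ u) (hΘ : ConditionTheta Θ a) (hz : ∀ k, 1 ≤ k → k ≤ K → 0 ≤ z k)
    (hk1 : 1 ≤ k) (hkK : k ≤ K) (hx : ∀ t ∈ interval t₀ N (K + 1), x t ≠ 0)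
    (hmem : ∀ j, k ≤ j → j ≤ K → adaptEst x t₀ N z j ∈ Θ) :
    (N k : ℝ) * KL (adaptEst x t₀ N z k) (adaptEst x t₀ N z K)
      ≤ a ^ 2 * cConst u ^ 2 * maxCrit K z k := by
  have hN0 : 0 < N 0 := by
    have h1 := (hMD.2.2.2 1 le_rfl (by omega)).1
    rcases Nat.eq_zero_or_pos (N 0) with h0 | h0
    · simp [h0] at h1; linarith [hMD.1]
    · exact h0
  have hu0 : 0 < u := hMD.1.trans_le hMD.2.1
  have hsu : Real.sqrt u < 1 := by
    rw [Real.sqrt_lt' one_pos]; simpa using hMD.2.2.1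
  have ha : 0 < a := one_pos.trans_le hΘ.2.1
  have hzle : ∀ l, k ≤ l → l ≤ K → z l ≤ maxCrit K z k := fun l h1 h2 =>
    le_csSup ((Set.finite_Icc k K).image z).bddAbove ⟨l, ⟨h1, h2⟩, rfl⟩
  have hz0 : 0 ≤ maxCrit K z k := (hz k hk1 hkK).trans (hzle k le_rfl hkK)
  set κ := lastAccepted x t₀ N z K with hκ
  have hκK : κ ≤ K := lastAccepted_le
  rcases le_total κ k with hle | hle
  · have : adaptEst x t₀ N z k = adaptEst x t₀ N z K := by
      rw [adaptEst, adaptEst, lastAccepted_of_le hkK, ← hκ, min_eq_right hle]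
    rw [this, KL_self (hΘ.1 (hmem K hkK le_rfl)).ne', mul_zero]
    positivity
  have hest : ∀ l, l ≤ κ → adaptEst x t₀ N z l = localEst x t₀ N l := fun l h2 => by
    rw [adaptEst, lastAccepted_of_le (h2.trans hκK), ← hκ, min_eq_left h2]
  have hestK : adaptEst x t₀ N z K = localEst x t₀ N κ := rfl
  have hq : ∀ l, k ≤ l → l ≤ κ → localEst x t₀ N l ∈ Θ := fun l h1 h2 => by
    rw [← hest l h2]; exact hmem l h1 (h2.trans hκK)
  rw [hest k hle, hestK]
  have htri := sqrt_KL_le_sum hΘ (fun l => localEst x t₀ N l) k κ hle hq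
  have hstep : ∀ l ∈ Finset.Ico k κ,
      Real.sqrt (N k) * Real.sqrt (KL (localEst x t₀ N l) (localEst x t₀ N (l + 1)))
        ≤ Real.sqrt u ^ (l - k) * Real.sqrt (maxCrit K z k) := by
    intro l hl
    rw [Finset.mem_Ico] at hl
    have e1 := length_mul_KL_le_testStat (x := x) (t₀ := t₀) (N := N) (k := l)
      (hN0.trans_le (monotoneOn_lengths hN (Nat.zero_le _) (by omega)))
      (by have := hN (l - 1) (by omega); rwa [Nat.sub_add_cancel (by omega)] at this)
      (hN l (by omega)) ((monotoneOn_lengths hN (by omega) le_rfl).trans_lt ht₀)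
      (fun t ht => hx t (interval_subset (monotoneOn_lengths hN (by omega) le_rfl) ht))
    have e2 : testStat x t₀ N l ≤ z l := lastAccepted_spec (by omega) (k := K) (by omega)
    have e3 := hzle l hl.1 (by omega)
    have e4 := lengths_le_pow_mul hMD (k := k) (j := l - k) (by omega)
    rw [show k + (l - k) = l by omega] at e4
    have e5 := KL_nonneg (hΘ.1 (hq l hl.1 hl.2.le)) (hΘ.1 (hq (l + 1) (by omega) (by omega)))
    have hpow : Real.sqrt u ^ (l - k) = Real.sqrt (u ^ (l - k)) := by
      rw [eq_comm, Real.sqrt_eq_iff_mul_self_eq (by positivity) (by positivity), ← mul_pow,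
        Real.mul_self_sqrt hu0.le]
    rw [← Real.sqrt_mul (Nat.cast_nonneg _), hpow,
      ← Real.sqrt_mul (by positivity)]
    apply Real.sqrt_le_sqrt
    calc (N k : ℝ) * KL (localEst x t₀ N l) (localEst x t₀ N (l + 1))
        ≤ u ^ (l - k) * N l * KL (localEst x t₀ N l) (localEst x t₀ N (l + 1)) := by gcongr
      _ = u ^ (l - k) * (N l * KL (localEst x t₀ N l) (localEst x t₀ N (l + 1))) := by ring
      _ ≤ _ := by gcongr; linarith
  have hgeo : ∑ l ∈ Finset.Ico k κ, Real.sqrt u ^ (l - k) ≤ cConst u := by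
    rw [Finset.sum_Ico_eq_sum_range]
    simp only [Nat.add_sub_cancel_left]
    rw [cConst, ← tsum_geometric_of_lt_one (Real.sqrt_nonneg u) hsu]
    exact (summable_geometric_of_lt_one (Real.sqrt_nonneg u) hsu).sum_le_tsum _
      fun i _ => by positivity
  have hKL := KL_nonneg (hΘ.1 (hq k le_rfl hle)) (hΘ.1 (hq κ hle le_rfl))
  have hmain : Real.sqrt (N k * KL (localEst x t₀ N k) (localEst x t₀ N κ))
      ≤ a * cConst u * Real.sqrt (maxCrit K z k) := by
    calc Real.sqrt (N k * KL (localEst x t₀ N k) (localEst x t₀ N κ))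
        = Real.sqrt (N k) * Real.sqrt (KL (localEst x t₀ N k) (localEst x t₀ N κ)) :=
          Real.sqrt_mul (Nat.cast_nonneg _) _
      _ ≤ Real.sqrt (N k) * (a * ∑ l ∈ Finset.Ico k κ,
            Real.sqrt (KL (localEst x t₀ N l) (localEst x t₀ N (l + 1)))) := by gcongr
      _ = a * ∑ l ∈ Finset.Ico k κ, Real.sqrt (N k)
            * Real.sqrt (KL (localEst x t₀ N l) (localEst x t₀ N (l + 1))) := by
          rw [← Finset.mul_sum]; ring
      _ ≤ a * ∑ l ∈ Finset.Ico k κ, Real.sqrt u ^ (l - k) * Real.sqrt (maxCrit K z k) := by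
          exact mul_le_mul_of_nonneg_left (Finset.sum_le_sum hstep) ha.le
      _ = a * (∑ l ∈ Finset.Ico k κ, Real.sqrt u ^ (l - k)) * Real.sqrt (maxCrit K z k) := by
          rw [← Finset.sum_mul]; ring
      _ ≤ _ := by gcongr
  have := (Real.sqrt_le_left (by have : 0 ≤ cConst u := inv_nonneg.2 (by linarith)
                                 positivity)).1 hmain
  rwa [mul_pow, mul_pow, Real.sq_sqrt hz0] at this

/-! ### Measurability of the loss -/

/-- A supremum of continuous functions over a separable space is measurable, whether or not the
suprema are finite: it is the supremum over a countable dense set. -/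
theorem measurable_iSup_of_continuous {X α : Type*} [TopologicalSpace X]
    [TopologicalSpace.SeparableSpace X] [MeasurableSpace α] {f : X → α → ℝ}
    (hc : ∀ a, Continuous fun p => f p a) (hm : ∀ p, Measurable (f p)) :
    Measurable fun a => ⨆ p, f p a := by
  obtain ⟨S, hS, hd⟩ := TopologicalSpace.exists_countable_dense X
  have : Countable S := hS
  have h : (fun a => ⨆ p, f p a) = fun a => ⨆ p : S, f p a :=
    funext fun a => (hd.ciSup' (hc a)).symm
  rw [h]
  exact Measurable.iSup fun p => hm p

theorem continuous_logLik (x : ℕ → ℝ) (I : Finset ℕ) :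
    Continuous fun θ : Set.Ioi (0 : ℝ) => logLik x I θ := by
  have h0 : ∀ θ : Set.Ioi (0 : ℝ), (θ : ℝ) ≠ 0 := fun θ => (Set.mem_Ioi.1 θ.2).ne'
  simp only [logLik_eq]
  refine Continuous.sub (continuous_const.mul (Continuous.log (by fun_prop) fun θ => ?_))
    (continuous_const.div (by fun_prop) fun θ => mul_ne_zero two_ne_zero (h0 θ))
  exact mul_ne_zero (by positivity) (h0 θ)

theorem measurable_logLik (I : Finset ℕ) (θ : ℝ) : Measurable fun x : ℕ → ℝ => logLik x I θ := by
  unfold logLik logDensity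
  fun_prop

theorem measurable_changePointStat (t' t'' τ : ℕ) :
    Measurable fun x : ℕ → ℝ => changePointStat x t' t'' τ := by
  refine Measurable.sub (measurable_iSup_of_continuous (fun x => ?_) fun p => ?_)
    (measurable_iSup_of_continuous (fun x => continuous_logLik x _) fun θ => measurable_logLik _ _)
  · exact ((continuous_logLik x _).comp continuous_fst).add
      ((continuous_logLik x _).comp continuous_snd)
  · exact (measurable_logLik _ _).add (measurable_logLik _ _)

theorem measurable_testStat (t₀ : ℕ) (N : ℕ → ℕ) (k : ℕ) :
    Measurable fun x : ℕ → ℝ => testStat x t₀ N k :=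
  Measurable.iSup fun _ => measurable_changePointStat _ _ _

theorem measurable_lastAccepted (t₀ : ℕ) (N : ℕ → ℕ) (z : ℕ → ℝ) (k : ℕ) :
    Measurable fun x : ℕ → ℝ => lastAccepted x t₀ N z k := by
  have key : ∀ (p : (ℕ → ℝ) → ℕ → Prop) (_ : ∀ x, DecidablePred (p x)),
      (∀ j ≤ k, MeasurableSet {x | p x j}) → Measurable fun x => Nat.findGreatest (p x) k :=
    fun p _ h => measurable_findGreatest h
  refine key (fun x j => ∀ l, 1 ≤ l → l ≤ j → testStat x t₀ N l ≤ z l)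
    (fun _ _ => Classical.propDecidable _) fun j _ => ?_
  simp only [Set.ofPred_forall]
  exact MeasurableSet.iInter fun l => MeasurableSet.iInter fun _ => MeasurableSet.iInter fun _ =>
    measurableSet_le (measurable_testStat _ _ _) measurable_const

theorem measurable_localEst (t₀ : ℕ) (N : ℕ → ℕ) (k : ℕ) :
    Measurable fun x : ℕ → ℝ => localEst x t₀ N k := by
  unfold localEst mle
  fun_prop

theorem measurable_adaptEst (t₀ : ℕ) (N : ℕ → ℕ) (z : ℕ → ℝ) (k : ℕ) :
    Measurable fun x : ℕ → ℝ => adaptEst x t₀ N z k := by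
  have h : Measurable fun p : ℕ × (ℕ → ℝ) => localEst p.2 t₀ N p.1 :=
    measurable_from_prod_countable_right fun j => measurable_localEst t₀ N j
  exact h.comp ((measurable_lastAccepted t₀ N z k).prodMk measurable_id)

theorem measurable_normLoss (t₀ : ℕ) (N : ℕ → ℕ) (z : ℕ → ℝ) (r α : ℝ) (k : ℕ) :
    Measurable (normLoss t₀ N z r α k) := by
  have h1 := measurable_localEst t₀ N k
  have h2 := measurable_adaptEst t₀ N z k
  unfold normLoss KL
  have h3 : Measurable fun x : ℕ → ℝ => |(N k : ℝ)
      * (-(Real.log (localEst x t₀ N k / adaptEst x t₀ N z k) + 1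
        - localEst x t₀ N k / adaptEst x t₀ N z k) / 2)| :=
    ((((((h1.div h2).log).add_const 1).sub (h1.div h2)).neg.div_const 2).const_mul _).abs
  exact (h3.pow_const r).div_const _

theorem riskBound_pos {r : ℝ} (hr : 0 < r) : 0 < riskBound r := by
  have := Real.Gamma_pos_of_pos hr
  unfold riskBound
  positivity

theorem normLoss_nonneg (t₀ : ℕ) (N : ℕ → ℕ) (z : ℕ → ℝ) {r α : ℝ} (hr : 0 < r) (hα : 0 < α)
    (k : ℕ) (x : ℕ → ℝ) : 0 ≤ normLoss t₀ N z r α k x := by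
  have := riskBound_pos hr
  unfold normLoss
  positivity

/-! ### The parametric measure -/

instance (θ : ℝ) : IsProbabilityMeasure (paramMeasure θ) := by
  unfold paramMeasure; infer_instance

theorem ae_paramMeasure_ne_zero {θ : ℝ} (hθ : 0 < θ) : ∀ᵐ x ∂paramMeasure θ, ∀ t, x t ≠ 0 := by
  rw [ae_all_iff]
  intro t
  have h : (paramMeasure θ).map (fun x => x t) = gaussianReal 0 θ.toNNReal :=
    Measure.infinitePi_map_eval _ t
  have h0 : ∀ᵐ y ∂gaussianReal 0 θ.toNNReal, y ≠ 0 := by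
    have := nullSingletonClass_gaussianReal (μ := 0) (v := θ.toNNReal) (by simpa using hθ)
    exact Measure.ae_ne _ 0
  rw [← h] at h0
  exact ae_of_ae_map (measurable_pi_apply t).aemeasurable h0

theorem paramMeasure_map_mul {θ' θ : ℝ} (h' : 0 < θ') (h : 0 < θ) :
    (paramMeasure θ').map (fun x t => Real.sqrt (θ / θ') * x t) = paramMeasure θ := by
  have := Measure.infinitePi_map_pi (fun _ : ℕ => gaussianReal 0 θ'.toNNReal)
    (f := fun _ y => Real.sqrt (θ / θ') * y) fun _ => by fun_prop
  rw [paramMeasure, this, paramMeasure]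
  congr 1
  ext1 t
  rw [gaussianReal_map_const_mul]
  congr 1
  · simp
  · ext
    simp only [NNReal.coe_mul, NNReal.coe_mk, Real.coe_toNNReal _ h'.le, Real.coe_toNNReal _ h.le,
      Real.sq_sqrt (div_pos h h').le]
    field_simp

/-- The loss has the same law under all parametric measures, so that the propagation condition
at one parameter bounds the risk at every other. -/
theorem lintegral_normLoss_le {t₀ K : ℕ} {N : ℕ → ℕ} {z : ℕ → ℝ} {r α θstar θ : ℝ}
    (hN : ∀ k, k ≤ K → N k < N (k + 1)) (ht₀ : N (K + 1) < t₀) (hr : 0 < r) (hα : 0 < α)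
    (hθstar : 0 < θstar) (hprop : Propagation t₀ K N z r α θstar) (hθ : 0 < θ) {k : ℕ}
    (hk1 : 1 ≤ k) (hkK : k ≤ K) :
    ∫⁻ x, ENNReal.ofReal (normLoss t₀ N z r α k x) ∂paramMeasure θ ≤ 1 := by
  have hρ : 0 < α * riskBound r := mul_pos hα (riskBound_pos hr)
  have hm := (measurable_normLoss t₀ N z r α k).ennreal_ofReal
  rw [← paramMeasure_map_mul hθstar hθ, lintegral_map hm (by fun_prop)]
  have hae : ∀ᵐ x ∂paramMeasure θstar,
      ENNReal.ofReal (normLoss t₀ N z r α k fun t => Real.sqrt (θ / θstar) * x t)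
        = ENNReal.ofReal (|(N k : ℝ) * KL (localEst x t₀ N k) (adaptEst x t₀ N z k)| ^ r)
          * (ENNReal.ofReal (α * riskBound r))⁻¹ := by
    filter_upwards [ae_paramMeasure_ne_zero hθstar] with x hx
    rw [normLoss_const_mul (Real.sqrt_pos.2 (div_pos hθ hθstar)).ne' hN ht₀ hkK hx, normLoss,
      ENNReal.ofReal_div_of_pos hρ, ENNReal.div_eq_inv_mul, mul_comm]
  rw [lintegral_congr_ae hae, lintegral_mul_const' _ _ (by simp [hρ])]
  calc _ ≤ ENNReal.ofReal (α * riskBound r) * (ENNReal.ofReal (α * riskBound r))⁻¹ := by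
        gcongr; exact hprop k hk1 hkK
    _ = 1 := ENNReal.mul_inv_cancel (by simp [hρ]) (by simp)

/-- Resampling one coordinate of an i.i.d. sequence does not change its law. -/
theorem paramMeasure_resample (θ : ℝ) (n : ℕ) {F : (ℕ → ℝ) → ENNReal} (hF : Measurable F) :
    ∫⁻ y, ∫⁻ x, F (Function.update x n y) ∂paramMeasure θ ∂gaussianReal 0 θ.toNNReal
      = ∫⁻ x, F x ∂paramMeasure θ := by
  have hupd : Measurable fun p : ℝ × (ℕ → ℝ) => Function.update p.2 n p.1 := by
    refine measurable_pi_lambda _ fun t => ?_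
    rcases eq_or_ne t n with h | h
    · subst h; simpa using measurable_fst
    · simp only [Function.update_of_ne h]
      fun_prop
  have hmap : ((gaussianReal 0 θ.toNNReal).prod (paramMeasure θ)).map
      (fun p => Function.update p.2 n p.1) = paramMeasure θ := by
    refine Measure.eq_infinitePi _ fun s t ht => ?_
    rw [Measure.map_apply hupd (MeasurableSet.pi s.countable_toSet fun i _ => ht i)]
    by_cases hn : n ∈ s
    · have hset : (fun p : ℝ × (ℕ → ℝ) => Function.update p.2 n p.1) ⁻¹' (s : Set ℕ).pi t
          = t n ×ˢ ((s.erase n : Finset ℕ) : Set ℕ).pi t := by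
        ext p
        simp only [Set.mem_preimage, Set.mem_pi, Set.mem_prod, Finset.coe_erase, Set.mem_sdiff,
          Finset.mem_coe, Set.mem_singleton_iff]
        constructor
        · intro h
          refine ⟨by simpa using h n hn, fun i hi => ?_⟩
          simpa [Function.update_of_ne hi.2] using h i hi.1
        · rintro ⟨h1, h2⟩ i hi
          rcases eq_or_ne i n with h | h
          · subst h; simpa using h1
          · simpa [Function.update_of_ne h] using h2 i ⟨hi, h⟩
      rw [hset, Measure.prod_prod, paramMeasure, Measure.infinitePi_pi _ fun i _ => ht i,
        Finset.mul_prod_erase s (fun i => gaussianReal 0 θ.toNNReal (t i)) hn]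
    · have hset : (fun p : ℝ × (ℕ → ℝ) => Function.update p.2 n p.1) ⁻¹' (s : Set ℕ).pi t
          = Set.univ ×ˢ (s : Set ℕ).pi t := by
        ext p
        simp only [Set.mem_preimage, Set.mem_pi, Set.mem_prod, Set.mem_univ, true_and]
        refine forall₂_congr fun i hi => ?_
        rw [Function.update_of_ne (ne_of_mem_of_not_mem hi hn)]
      rw [hset, Measure.prod_prod, paramMeasure, Measure.infinitePi_pi _ fun i _ => ht i,
        measure_univ, one_mul]
  rw [← lintegral_prod (fun p : ℝ × (ℕ → ℝ) => F (Function.update p.2 n p.1))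
    (hF.comp hupd).aemeasurable, ← lintegral_map hF hupd, hmap]

/-! ### Predictability and independence in the volatility model -/

/-- The returns before time `n`, with zeros at all other times. -/
def past (n : ℕ) (x : ℕ → ℝ) : ℕ → ℝ := fun t => if t ∈ Finset.Ico 1 n then x t else 0

theorem past_past {m n : ℕ} (h : m ≤ n) (x : ℕ → ℝ) : past m (past n x) = past m x := by
  funext t
  unfold past
  by_cases ht : t ∈ Finset.Ico 1 m
  · rw [if_pos ht, if_pos ht, if_pos (Finset.Ico_subset_Ico_right h ht)]
  · rw [if_neg ht, if_neg ht]

theorem past_apply {n t : ℕ} (h : t ∈ Finset.Ico 1 n) (x : ℕ → ℝ) : past n x t = x t := if_pos h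

theorem measurable_past (n : ℕ) : Measurable (past n) := by
  refine measurable_pi_lambda _ fun t => ?_
  unfold past
  split_ifs <;> fun_prop

theorem measurable_past_comp {Ω : Type*} {m : MeasurableSpace Ω} {R : ℕ → Ω → ℝ} {n : ℕ}
    (h : ∀ t ∈ Finset.Ico 1 n, Measurable (R t)) : Measurable fun ω => past n fun i => R i ω := by
  refine measurable_pi_lambda _ fun t => ?_
  unfold past
  split_ifs with ht
  · exact h t ht
  · fun_prop

variable {Ω : Type*} [MeasurableSpace Ω] {P : Measure Ω} {ε σ R : ℕ → Ω → ℝ}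

theorem IsVolatilityModel.exists_vol_eq (h : IsVolatilityModel P ε σ R) {t : ℕ} (ht : 1 ≤ t) :
    ∃ s : (ℕ → ℝ) → ℝ, Measurable s ∧ ∀ ω, σ t ω = s (past t fun i => R i ω) := by
  have hle : (⨆ s ∈ Set.Ico 1 t, MeasurableSpace.comap (R s) inferInstance)
      ≤ MeasurableSpace.comap (fun ω => past t fun i => R i ω) inferInstance := by
    refine iSup₂_le fun s hs => ?_
    have hRs : R s = (fun x : ℕ → ℝ => x s) ∘ fun ω => past t fun i => R i ω := by
      funext ω
      exact (past_apply (Finset.mem_Ico.2 hs) fun i => R i ω).symm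
    rw [hRs, ← MeasurableSpace.comap_comp]
    exact MeasurableSpace.comap_mono (measurable_pi_apply s).comap_le
  obtain ⟨s, hs, hσ⟩ := ((h.predictable t ht).mono hle le_rfl).exists_eq_measurable_comp
  exact ⟨s, hs, fun ω => congrFun hσ ω⟩

/-- Each return is a function of the innovations up to the same time. -/
theorem IsVolatilityModel.measurable_return_innovations (h : IsVolatilityModel P ε σ R) (t : ℕ)
    (ht : 1 ≤ t) {n : ℕ} (htn : t < n) :
    Measurable[⨆ s ∈ Set.Ico 1 n, MeasurableSpace.comap (ε s) inferInstance] (R t) := by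
  induction t using Nat.strong_induction_on with
  | _ t ih =>
    have hσ : Measurable[⨆ s ∈ Set.Ico 1 n, MeasurableSpace.comap (ε s) inferInstance] (σ t) := by
      refine (h.predictable t ht).mono (iSup₂_le fun s hs => ?_) le_rfl
      exact (ih s hs.2 hs.1 (hs.2.trans htn)).comap_le
    have hε : Measurable[⨆ s ∈ Set.Ico 1 n, MeasurableSpace.comap (ε s) inferInstance] (ε t) :=
      (comap_measurable (ε t)).mono
        (le_iSup₂ (f := fun s (_ : s ∈ Set.Ico 1 n) => MeasurableSpace.comap (ε s) inferInstance)
          t ⟨ht, htn⟩) le_rfl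
    have hR : R t = fun ω => σ t ω * ε t ω := funext (h.return_eq t ht)
    rw [hR]
    exact hσ.mul hε

theorem IsVolatilityModel.measurable_return (h : IsVolatilityModel P ε σ R) {t : ℕ}
    (ht : 1 ≤ t) : Measurable (R t) :=
  (h.measurable_return_innovations t ht (Nat.lt_succ_self t)).mono
    (iSup₂_le fun s hs => (h.measurable_innovation s hs.1).comap_le) le_rfl

theorem IsVolatilityModel.measurable_past (h : IsVolatilityModel P ε σ R) (n : ℕ) :
    Measurable fun ω => past n fun i => R i ω :=
  measurable_past_comp fun _ ht => h.measurable_return (Finset.mem_Ico.1 ht).1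

theorem IsVolatilityModel.measurable_vol (h : IsVolatilityModel P ε σ R) {t : ℕ} (ht : 1 ≤ t) :
    Measurable (σ t) := by
  obtain ⟨s, hs, hσ⟩ := h.exists_vol_eq ht
  rw [funext hσ]
  exact hs.comp (h.measurable_past t)

theorem IsVolatilityModel.indepFun_past (h : IsVolatilityModel P ε σ R) {n : ℕ} (hn : 1 ≤ n) :
    IndepFun (fun ω => past n fun i => R i ω) (ε n) P := by
  have hdisj : Disjoint {i : Set.Ici (1 : ℕ) | (i : ℕ) < n} {⟨n, hn⟩} := by
    rw [Set.disjoint_singleton_right]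
    exact lt_irrefl n
  have hind := indep_iSup_of_disjoint
    (fun i : Set.Ici (1 : ℕ) => (h.measurable_innovation i i.2).comap_le)
    h.indep_innovation hdisj
  refine indep_of_indep_of_le_left (indep_of_indep_of_le_right hind ?_) ?_
  · exact le_iSup₂ (f := fun (i : Set.Ici (1 : ℕ)) (_ : i ∈ ({⟨n, hn⟩} : Set (Set.Ici (1 : ℕ)))) =>
      MeasurableSpace.comap (ε i) inferInstance) ⟨n, hn⟩ rfl
  · refine Measurable.comap_le ?_
    refine measurable_past_comp fun t ht => ?_
    rw [Finset.mem_Ico] at ht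
    refine (h.measurable_return_innovations t ht.1 ht.2).mono (iSup₂_le fun s hs => ?_) le_rfl
    exact le_iSup₂ (f := fun (i : Set.Ici (1 : ℕ)) (_ : i ∈ {i : Set.Ici (1 : ℕ) | (i : ℕ) < n}) =>
      MeasurableSpace.comap (ε i) inferInstance) ⟨s, hs.1⟩ hs.2

theorem IsVolatilityModel.indepFun_vol (h : IsVolatilityModel P ε σ R) {n : ℕ} (hn : 1 ≤ n) :
    IndepFun (σ n) (ε n) P := by
  obtain ⟨s, hs, hσ⟩ := h.exists_vol_eq hn
  rw [funext hσ]
  exact (h.indepFun_past hn).comp hs measurable_id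

theorem IsVolatilityModel.ae_return_ne_zero (h : IsVolatilityModel P ε σ R) :
    ∀ᵐ ω ∂P, ∀ t, 1 ≤ t → R t ω ≠ 0 := by
  rw [ae_all_iff]
  intro t
  by_cases ht : 1 ≤ t
  · have h0 : ∀ᵐ y ∂P.map (ε t), y ≠ 0 := by
      rw [h.law_innovation t ht]
      have := nullSingletonClass_gaussianReal (μ := 0) (v := 1) one_ne_zero
      exact Measure.ae_ne _ 0
    filter_upwards [ae_of_ae_map (h.measurable_innovation t ht).aemeasurable h0] with ω hω _
    rw [h.return_eq t ht]
    exact mul_ne_zero (h.vol_pos t ht ω).ne' hω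
  · exact Filter.Eventually.of_forall fun _ h' => absurd h' ht

/-! ### Change of measure -/

noncomputable section

/-- The likelihood ratio at `y` of `𝓝(0, θ)` with respect to `𝓝(0, s ^ 2)`. -/
def weight (θ s y : ℝ) : ℝ :=
  s / Real.sqrt θ * Real.exp (y ^ 2 / (2 * s ^ 2) - y ^ 2 / (2 * θ))

/-- The path that follows `w` on `[m, n[` and `x` elsewhere. -/
def splice (m n : ℕ) (w x : ℕ → ℝ) : ℕ → ℝ := fun t => if t ∈ Finset.Ico m n then w t else x t

/-- The likelihood ratio of the parametric model with respect to the volatility model on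
`[m, n[`. -/
def likRatio (θ : ℝ) (m n : ℕ) (σ R : ℕ → Ω → ℝ) (ω : Ω) : ℝ :=
  ∏ t ∈ Finset.Ico m n, weight θ (σ t ω) (R t ω)

end

theorem weight_pos {θ s : ℝ} (hθ : 0 < θ) (hs : 0 < s) (y : ℝ) : 0 < weight θ s y := by
  unfold weight; positivity

theorem measurable_weight (θ : ℝ) : Measurable fun p : ℝ × ℝ => weight θ p.1 p.2 := by
  unfold weight
  fun_prop

theorem gaussianPDF_mul_weight {θ s : ℝ} (hθ : 0 < θ) (hs : 0 < s) (y : ℝ) :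
    gaussianPDF 0 (s ^ 2).toNNReal y * ENNReal.ofReal (weight θ s y)
      = gaussianPDF 0 θ.toNNReal y := by
  rw [gaussianPDF, gaussianPDF, ← ENNReal.ofReal_mul (gaussianPDFReal_nonneg _ _ _)]
  congr 1
  rw [gaussianPDFReal, gaussianPDFReal, weight, Real.coe_toNNReal _ hθ.le,
    Real.coe_toNNReal _ (sq_nonneg s), Real.sqrt_mul (by positivity) (s ^ 2),
    Real.sqrt_mul (by positivity) θ, Real.sqrt_sq hs.le]
  have h1 : Real.exp (-(y - 0) ^ 2 / (2 * θ))
      = Real.exp (-(y - 0) ^ 2 / (2 * s ^ 2))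
        * Real.exp (y ^ 2 / (2 * s ^ 2) - y ^ 2 / (2 * θ)) := by
    rw [← Real.exp_add]; congr 1; ring
  rw [h1]
  have := Real.sqrt_pos.2 hθ
  have := Real.sqrt_pos.2 (mul_pos two_pos Real.pi_pos)
  generalize Real.sqrt (2 * Real.pi) = c at *
  field_simp

theorem lintegral_weight {θ s : ℝ} (hθ : 0 < θ) (hs : 0 < s) {g : ℝ → ENNReal}
    (hg : Measurable g) :
    ∫⁻ v, g (s * v) * ENNReal.ofReal (weight θ s (s * v)) ∂gaussianReal 0 1
      = ∫⁻ y, g y ∂gaussianReal 0 θ.toNNReal := by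
  have hw : Measurable fun y => ENNReal.ofReal (weight θ s y) :=
    ((measurable_weight θ).comp (measurable_const.prodMk measurable_id)).ennreal_ofReal
  have hmap : (gaussianReal 0 1).map (fun v => s * v) = gaussianReal 0 (s ^ 2).toNNReal := by
    rw [gaussianReal_map_const_mul]
    congr 1
    · simp
    · ext; simp [Real.coe_toNNReal _ (sq_nonneg s)]
  rw [← lintegral_map (f := fun y => g y * ENNReal.ofReal (weight θ s y)) (hg.mul hw)
    (by fun_prop), hmap, gaussianReal_of_var_ne_zero _ (by simp [hs.ne']),
    gaussianReal_of_var_ne_zero _ (by simpa using hθ),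
    lintegral_withDensity_eq_lintegral_mul _ (measurable_gaussianPDF _ _)
      (g := fun y => g y * ENNReal.ofReal (weight θ s y)) (hg.mul hw),
    lintegral_withDensity_eq_lintegral_mul _ (measurable_gaussianPDF _ _) hg]
  refine lintegral_congr fun y => ?_
  simp only [Pi.mul_apply]
  rw [← gaussianPDF_mul_weight hθ hs y]
  ring

/-- One step of the change of measure: weighting turns a conditional law `𝓝(0, s ^ 2)` with a
volatility `s` depending on the past into `𝓝(0, θ)`. -/
theorem lintegral_weight_of_indepFun [IsProbabilityMeasure P] {β : Type*} [MeasurableSpace β]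
    {W : Ω → β} {e : Ω → ℝ} (hW : Measurable W) (he : Measurable e) (hind : IndepFun W e P)
    (hlaw : P.map e = gaussianReal 0 1) {s : β → ℝ} (hs : Measurable s) (hs0 : ∀ ω, 0 < s (W ω))
    {θ : ℝ} (hθ : 0 < θ) {G : β → ℝ → ENNReal} (hG : Measurable fun p : β × ℝ => G p.1 p.2) :
    ∫⁻ ω, G (W ω) (s (W ω) * e ω) * ENNReal.ofReal (weight θ (s (W ω)) (s (W ω) * e ω)) ∂P
      = ∫⁻ ω, ∫⁻ y, G (W ω) y ∂gaussianReal 0 θ.toNNReal ∂P := by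
  have hm : Measurable fun p : β × ℝ =>
      G p.1 (s p.1 * p.2) * ENNReal.ofReal (weight θ (s p.1) (s p.1 * p.2)) := by
    have h1 : Measurable fun p : β × ℝ => s p.1 * p.2 := (hs.comp measurable_fst).mul measurable_snd
    exact (hG.comp (measurable_fst.prodMk h1)).mul
      ((measurable_weight θ).comp ((hs.comp measurable_fst).prodMk h1)).ennreal_ofReal
  rw [← lintegral_map (f := fun p : β × ℝ =>
      G p.1 (s p.1 * p.2) * ENNReal.ofReal (weight θ (s p.1) (s p.1 * p.2)))
      (g := fun ω => (W ω, e ω)) hm (hW.prodMk he),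
    (indepFun_iff_map_prod_eq_prod_map_map hW.aemeasurable he.aemeasurable).1 hind, hlaw,
    lintegral_prod _ hm.aemeasurable, lintegral_map hm.lintegral_prod_right' hW]
  exact lintegral_congr fun ω =>
    lintegral_weight hθ (hs0 ω) (hG.comp (measurable_const.prodMk measurable_id))

theorem splice_self (m : ℕ) (w x : ℕ → ℝ) : splice m m w x = x := by
  funext t
  simp [splice]

theorem splice_succ {m n : ℕ} (h : m ≤ n) (w x : ℕ → ℝ) :
    splice m (n + 1) w x = splice m n w (Function.update x n (w n)) := by
  funext t
  simp only [splice, Finset.mem_Ico, Function.update_apply]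
  rcases eq_or_ne t n with rfl | ht
  · simp [h]
  · simp only [if_neg ht]
    refine if_congr ?_ rfl rfl
    omega

theorem splice_past {m n : ℕ} (h : 1 ≤ m) (w x : ℕ → ℝ) :
    splice m n (past n w) x = splice m n w x := by
  funext t
  unfold splice
  split_ifs with ht
  · exact past_apply (Finset.Ico_subset_Ico_left h ht) w
  · rfl

theorem measurable_splice (m n : ℕ) :
    Measurable fun p : (ℕ → ℝ) × (ℕ → ℝ) => splice m n p.1 p.2 := by
  refine measurable_pi_lambda _ fun t => ?_
  unfold splice
  split_ifs <;> fun_prop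

theorem IsVolatilityModel.likRatio_pos (h : IsVolatilityModel P ε σ R) {θ : ℝ} (hθ : 0 < θ)
    {m : ℕ} (hm : 1 ≤ m) (n : ℕ) (ω : Ω) : 0 < likRatio θ m n σ R ω :=
  Finset.prod_pos fun t ht =>
    weight_pos hθ (h.vol_pos t (hm.trans (Finset.mem_Ico.1 ht).1) ω) _

theorem IsVolatilityModel.measurable_likRatio (h : IsVolatilityModel P ε σ R) (θ : ℝ)
    {m : ℕ} (hm : 1 ≤ m) (n : ℕ) : Measurable (likRatio θ m n σ R) := by
  unfold likRatio
  refine Finset.measurable_prod _ fun t ht => ?_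
  have ht1 := hm.trans (Finset.mem_Ico.1 ht).1
  exact (measurable_weight θ).comp ((h.measurable_vol ht1).prodMk (h.measurable_return ht1))

/-- Change of measure: weighted by the likelihood ratio on `[m, n[`, the returns on `[m, n[` are
i.i.d. `𝓝(0, θ)`.  The remaining coordinates of the i.i.d. path are kept random, which lets the
induction on `n` move one coordinate at a time. -/
theorem IsVolatilityModel.lintegral_splice_mul_likRatio [IsProbabilityMeasure P]
    (h : IsVolatilityModel P ε σ R) {θ : ℝ} (hθ : 0 < θ) {m n : ℕ} (hm : 1 ≤ m) (hmn : m ≤ n)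
    {F : (ℕ → ℝ) → ENNReal} (hF : Measurable F) :
    ∫⁻ ω, (∫⁻ x, F (splice m n (fun t => R t ω) x) ∂paramMeasure θ)
        * ENNReal.ofReal (likRatio θ m n σ R ω) ∂P
      = ∫⁻ x, F x ∂paramMeasure θ := by
  have hex : ∀ t, ∃ s : (ℕ → ℝ) → ℝ, Measurable s ∧
      (1 ≤ t → ∀ ω, σ t ω = s (past t fun i => R i ω)) := by
    intro t
    by_cases ht : 1 ≤ t
    · obtain ⟨s, hs, hσ⟩ := h.exists_vol_eq ht
      exact ⟨s, hs, fun _ => hσ⟩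
    · exact ⟨fun _ => 0, measurable_const, fun h' => absurd h' ht⟩
  choose s hs hσ using hex
  induction n, hmn using Nat.le_induction with
  | base => simp [splice_self, likRatio]
  | succ n hmn ih =>
    have hn : 1 ≤ n := hm.trans hmn
    -- The likelihood ratio before time `n` as a function of the past.
    set Z : (ℕ → ℝ) → ℝ := fun w => ∏ t ∈ Finset.Ico m n, weight θ (s t (past t w)) (w t) with hZ
    have hZm : Measurable Z := by
      refine Finset.measurable_prod _ fun t _ => ?_
      exact (measurable_weight θ).comp
        (((hs t).comp (LCP.measurable_past t)).prodMk (measurable_pi_apply t))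
    have hZR : ∀ ω, Z (past n fun i => R i ω) = likRatio θ m n σ R ω := by
      intro ω
      refine Finset.prod_congr rfl fun t ht => ?_
      have ht' := Finset.mem_Ico.1 ht
      rw [past_past ht'.2.le, past_apply (Finset.Ico_subset_Ico_left hm ht),
        ← hσ t (hm.trans ht'.1) ω]
    set G : (ℕ → ℝ) → ℝ → ENNReal := fun w y =>
      (∫⁻ x, F (splice m n w (Function.update x n y)) ∂paramMeasure θ)
        * ENNReal.ofReal (Z w) with hG
    have hupd : Measurable fun p : ((ℕ → ℝ) × ℝ) × (ℕ → ℝ) => Function.update p.2 n p.1.2 := by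
      refine measurable_pi_lambda _ fun t => ?_
      simp only [Function.update_apply]
      split_ifs <;> fun_prop
    have hGm : Measurable fun p : (ℕ → ℝ) × ℝ => G p.1 p.2 := by
      have h1 : Measurable fun q : ((ℕ → ℝ) × ℝ) × (ℕ → ℝ) =>
          F (splice m n q.1.1 (Function.update q.2 n q.1.2)) :=
        hF.comp ((measurable_splice m n).comp ((measurable_fst.comp measurable_fst).prodMk hupd))
      exact h1.lintegral_prod_right'.mul (hZm.comp measurable_fst).ennreal_ofReal
    have hstep := lintegral_weight_of_indepFun (h.measurable_past n) (h.measurable_innovation n hn)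
      (h.indepFun_past hn) (h.law_innovation n hn) (hs n)
      (fun ω => by rw [← hσ n hn ω]; exact h.vol_pos n hn ω) hθ hGm
    calc _ = _ := lintegral_congr fun ω => ?_
      _ = _ := hstep
      _ = ∫⁻ ω, (∫⁻ x, F (splice m n (fun t => R t ω) x) ∂paramMeasure θ)
            * ENNReal.ofReal (likRatio θ m n σ R ω) ∂P := lintegral_congr fun ω => ?_
      _ = _ := ih
    · rw [← hσ n hn ω, ← h.return_eq n hn ω]
      simp only [hG, hZR, splice_past hm]
      rw [likRatio, Finset.prod_Ico_succ_top hmn, ← likRatio,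
        ENNReal.ofReal_mul (h.likRatio_pos hθ hm n ω).le, ← mul_assoc]
      simp only [splice_succ hmn]
    · simp only [hG, hZR, splice_past hm]
      rw [lintegral_mul_const' _ _ ENNReal.ofReal_ne_top]
      congr 1
      exact paramMeasure_resample θ n
        (hF.comp ((measurable_splice m n).comp (measurable_const.prodMk measurable_id)))

/-! ### The modeling bias as expected log-likelihood ratio -/

/-- The log-likelihood ratio at `y = s v` is the Kullback–Leibler information up to a term that is
centered for a standard innovation `v`. -/
theorem neg_log_weight {θ s : ℝ} (hθ : 0 < θ) (hs : 0 < s) (v : ℝ) :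
    -Real.log (weight θ s (s * v)) = KL (s ^ 2) θ + (s ^ 2 / θ - 1) / 2 * (v ^ 2 - 1) := by
  have h1 := Real.sqrt_pos.2 hθ
  rw [weight, Real.log_mul (by positivity) (Real.exp_pos _).ne', Real.log_exp,
    Real.log_div hs.ne' h1.ne', Real.log_sqrt hθ.le, KL, Real.log_div (by positivity) hθ.ne',
    Real.log_pow]
  push_cast
  field_simp
  ring

theorem integral_sq_sub_one_gaussianReal :
    ∫ v : ℝ, (v ^ 2 - 1) ∂gaussianReal 0 1 = 0 := by
  have hv := variance_fun_id_gaussianReal (μ := 0) (v := 1)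
  rw [variance_eq_integral (by fun_prop), integral_id_gaussianReal] at hv
  simp only [sub_zero, NNReal.coe_one] at hv
  have hi : Integrable (fun v : ℝ => v ^ 2) (gaussianReal 0 1) :=
    (memLp_id_gaussianReal (μ := 0) (v := 1) 2).integrable_sq
  rw [integral_sub hi (integrable_const _), hv]
  simp

theorem div_le_KL {θ' θ : ℝ} (h' : 0 < θ') (h : 0 < θ) : θ' / θ ≤ 4 * KL θ' θ + 2 := by
  have hv := div_pos h' h
  have h1 := Real.log_le_sub_one_of_pos (half_pos hv)
  rw [Real.log_div hv.ne' two_ne_zero] at h1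
  have h2 := Real.log_le_sub_one_of_pos (show (0 : ℝ) < 2 by norm_num)
  unfold KL
  linarith

theorem IsVolatilityModel.integral_neg_log_likRatio [IsProbabilityMeasure P]
    (h : IsVolatilityModel P ε σ R) {θ : ℝ} (hθ : 0 < θ) {m n : ℕ} (hm : 1 ≤ m)
    (hint : Integrable (fun ω => ∑ t ∈ Finset.Ico m n, KL (σ t ω ^ 2) θ) P) :
    Integrable (fun ω => -Real.log (likRatio θ m n σ R ω)) P ∧
      ∫ ω, -Real.log (likRatio θ m n σ R ω) ∂P
        = ∫ ω, ∑ t ∈ Finset.Ico m n, KL (σ t ω ^ 2) θ ∂P := by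
  have ht1 : ∀ t ∈ Finset.Ico m n, 1 ≤ t := fun t ht => hm.trans (Finset.mem_Ico.1 ht).1
  have hKL0 : ∀ t ∈ Finset.Ico m n, ∀ ω, 0 ≤ KL (σ t ω ^ 2) θ := fun t ht ω =>
    KL_nonneg (pow_pos (h.vol_pos t (ht1 t ht) ω) 2) hθ
  have hrat : ∀ t ∈ Finset.Ico m n, Integrable (fun ω => (σ t ω ^ 2 / θ - 1) / 2) P := by
    intro t ht
    have hσm := h.measurable_vol (ht1 t ht)
    have hv : Integrable (fun ω => σ t ω ^ 2 / θ) P := by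
      refine Integrable.mono' ((hint.const_mul 4).add (integrable_const 2))
        ((hσm.pow_const 2).div_const θ).aestronglyMeasurable
        (Filter.Eventually.of_forall fun ω => ?_)
      have hp := pow_pos (h.vol_pos t (ht1 t ht) ω) 2
      rw [Real.norm_of_nonneg (by positivity)]
      refine (div_le_KL hp hθ).trans ?_
      have := Finset.single_le_sum (f := fun t => KL (σ t ω ^ 2) θ)
        (fun i hi => hKL0 i hi ω) ht
      simp only [Pi.add_apply]
      linarith
    exact (hv.sub (integrable_const 1)).div_const 2
  have hεi : ∀ t ∈ Finset.Ico m n, Integrable (fun ω => ε t ω ^ 2 - 1) P ∧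
      ∫ ω, (ε t ω ^ 2 - 1) ∂P = 0 := by
    intro t ht
    have hεm := h.measurable_innovation t (ht1 t ht)
    have hlaw := h.law_innovation t (ht1 t ht)
    have hg : Integrable (fun v : ℝ => v ^ 2 - 1) (gaussianReal 0 1) :=
      (memLp_id_gaussianReal (μ := 0) (v := 1) 2).integrable_sq.sub (integrable_const 1)
    rw [← hlaw] at hg
    refine ⟨hg.comp_measurable hεm, ?_⟩
    rw [← integral_map (f := fun v : ℝ => v ^ 2 - 1) hεm.aemeasurable hg.aestronglyMeasurable,
      hlaw, integral_sq_sub_one_gaussianReal]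
  have hind : ∀ t ∈ Finset.Ico m n,
      IndepFun (fun ω => (σ t ω ^ 2 / θ - 1) / 2) (fun ω => ε t ω ^ 2 - 1) P := fun t ht =>
    (h.indepFun_vol (ht1 t ht)).comp (φ := fun s : ℝ => (s ^ 2 / θ - 1) / 2)
      (ψ := fun v : ℝ => v ^ 2 - 1) (by fun_prop) (by fun_prop)
  have hmuli : ∀ t ∈ Finset.Ico m n,
      Integrable (fun ω => (σ t ω ^ 2 / θ - 1) / 2 * (ε t ω ^ 2 - 1)) P := fun t ht =>
    (hind t ht).integrable_mul (hrat t ht) (hεi t ht).1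
  have heq : (fun ω => -Real.log (likRatio θ m n σ R ω)) = fun ω =>
      ∑ t ∈ Finset.Ico m n, KL (σ t ω ^ 2) θ
        + ∑ t ∈ Finset.Ico m n, (σ t ω ^ 2 / θ - 1) / 2 * (ε t ω ^ 2 - 1) := by
    funext ω
    rw [likRatio, Real.log_prod fun t ht => (weight_pos hθ (h.vol_pos t (ht1 t ht) ω) _).ne',
      ← Finset.sum_neg_distrib, ← Finset.sum_add_distrib]
    refine Finset.sum_congr rfl fun t ht => ?_
    rw [h.return_eq t (ht1 t ht), neg_log_weight hθ (h.vol_pos t (ht1 t ht) ω)]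
  rw [heq]
  refine ⟨hint.add (integrable_finsetSum _ hmuli), ?_⟩
  rw [integral_add hint (integrable_finsetSum _ hmuli), integral_finsetSum _ hmuli,
    Finset.sum_eq_zero fun t ht => ?_, add_zero]
  have := (hind t ht).integral_mul_eq_mul_integral (hrat t ht).aestronglyMeasurable
    (hεi t ht).1.aestronglyMeasurable
  rw [(hεi t ht).2, mul_zero] at this
  exact this

/-! ### Transfer of risk bounds under small modeling bias -/

/-- A bound on the parametric risk gives a bound on the logarithmic risk in the volatility model,
up to the modeling bias.  With `Z` the likelihood ratio, `log ((1 + X) Z) ≤ (1 + X) Z - 1`, where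
`(1 + X) Z` has expectation at most `2` and `-log Z` has the modeling bias as expectation. -/
theorem IsVolatilityModel.integral_log_one_add_le [IsProbabilityMeasure P]
    (h : IsVolatilityModel P ε σ R) {θ : ℝ} (hθ : 0 < θ) {m n : ℕ} (hm : 1 ≤ m) (hmn : m ≤ n)
    (hint : Integrable (fun ω => ∑ t ∈ Finset.Ico m n, KL (σ t ω ^ 2) θ) P)
    {X : (ℕ → ℝ) → ℝ} (hX : Measurable X) (hX0 : ∀ x, 0 ≤ X x)
    (hloc : ∀ x y, (∀ t ∈ Finset.Ico m n, x t = y t) → X x = X y)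
    (hrisk : ∫⁻ x, ENNReal.ofReal (X x) ∂paramMeasure θ ≤ 1) :
    Integrable (fun ω => Real.log (1 + X fun t => R t ω)) P ∧
      ∫ ω, Real.log (1 + X fun t => R t ω) ∂P
        ≤ 1 + ∫ ω, ∑ t ∈ Finset.Ico m n, KL (σ t ω ^ 2) θ ∂P := by
  -- `R 0` need not be measurable, so `X` is evaluated at the path up to time `n - 1` only.
  have hXR : ∀ ω, X (fun t => R t ω) = X (past n fun t => R t ω) := fun ω =>
    hloc _ _ fun t ht => (past_apply (Finset.Ico_subset_Ico_left hm ht) fun t => R t ω).symm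
  have hXm : Measurable fun ω => X fun t => R t ω := by
    simp only [hXR]
    exact hX.comp (h.measurable_past n)
  have hZ0 := h.likRatio_pos hθ hm n
  have hY0 : ∀ ω, 0 ≤ (1 + X fun t => R t ω) * likRatio θ m n σ R ω := fun ω =>
    mul_nonneg (by linarith [hX0 fun t => R t ω]) (hZ0 ω).le
  have hYm : Measurable fun ω => (1 + X fun t => R t ω) * likRatio θ m n σ R ω :=
    (hXm.const_add 1).mul (h.measurable_likRatio θ hm n)
  have hYl : ∫⁻ ω, ENNReal.ofReal ((1 + X fun t => R t ω) * likRatio θ m n σ R ω) ∂P ≤ 2 := by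
    have hF : Measurable fun x => ENNReal.ofReal (1 + X x) := (hX.const_add 1).ennreal_ofReal
    have hch := h.lintegral_splice_mul_likRatio hθ hm hmn hF
    calc ∫⁻ ω, ENNReal.ofReal ((1 + X fun t => R t ω) * likRatio θ m n σ R ω) ∂P
        = ∫⁻ x, ENNReal.ofReal (1 + X x) ∂paramMeasure θ := by
          rw [← hch]
          refine lintegral_congr fun ω => ?_
          have hsp : ∀ x, X (splice m n (fun t => R t ω) x) = X fun t => R t ω := fun x =>
            hloc _ _ fun t ht => if_pos ht
          simp only [hsp, lintegral_const, measure_univ, mul_one]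
          rw [ENNReal.ofReal_mul (by linarith [hX0 fun t => R t ω])]
      _ = 1 + ∫⁻ x, ENNReal.ofReal (X x) ∂paramMeasure θ := by
          simp only [ENNReal.ofReal_add zero_le_one (hX0 _), ENNReal.ofReal_one]
          rw [lintegral_add_left measurable_const]
          simp
      _ ≤ 1 + 1 := by gcongr
      _ = 2 := one_add_one_eq_two
  have hYi : Integrable (fun ω => (1 + X fun t => R t ω) * likRatio θ m n σ R ω) P := by
    refine ⟨hYm.aestronglyMeasurable, ?_⟩
    rw [hasFiniteIntegral_iff_ofReal (Filter.Eventually.of_forall hY0)]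
    exact hYl.trans_lt ENNReal.ofNat_lt_top
  have hYle : ∫ ω, (1 + X fun t => R t ω) * likRatio θ m n σ R ω ∂P ≤ 2 := by
    rw [integral_eq_lintegral_of_nonneg_ae (Filter.Eventually.of_forall hY0)
      hYm.aestronglyMeasurable]
    exact ENNReal.toReal_le_of_le_ofReal two_pos.le (by simpa using hYl)
  obtain ⟨hLi, hLe⟩ := h.integral_neg_log_likRatio hθ hm hint
  have hbound : ∀ ω, Real.log (1 + X fun t => R t ω)
      ≤ (1 + X fun t => R t ω) * likRatio θ m n σ R ω - 1
        + -Real.log (likRatio θ m n σ R ω) := by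
    intro ω
    have hp : 0 < 1 + X fun t => R t ω := by linarith [hX0 fun t => R t ω]
    have := Real.log_le_sub_one_of_pos (mul_pos hp (hZ0 ω))
    rw [Real.log_mul hp.ne' (hZ0 ω).ne'] at this
    linarith
  have hi1 := hYi.sub (integrable_const (1 : ℝ))
  have hi : Integrable (fun ω => Real.log (1 + X fun t => R t ω)) P := by
    refine Integrable.mono' (hi1.add hLi)
      (hXm.const_add 1).log.aestronglyMeasurable (Filter.Eventually.of_forall fun ω => ?_)
    rw [Real.norm_of_nonneg (Real.log_nonneg (by linarith [hX0 fun t => R t ω]))]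
    exact hbound ω
  refine ⟨hi, ?_⟩
  calc _ ≤ _ := integral_mono hi (hi1.add hLi) hbound
    _ = ∫ ω, (1 + X fun t => R t ω) * likRatio θ m n σ R ω ∂P - 1
        + ∫ ω, ∑ t ∈ Finset.Ico m n, KL (σ t ω ^ 2) θ ∂P := by
      rw [integral_add' hi1 hLi, integral_sub' hYi (integrable_const _), hLe]
      simp
    _ ≤ _ := by linarith

end LCP

open LCP
theorem theorem4p6 {Ω : Type*} [MeasurableSpace Ω] (P : Measure Ω) [IsProbabilityMeasure P]
    (ε σ R : ℕ → Ω → ℝ) (hmodel : IsVolatilityModel P ε σ R)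
    -- point of estimation, number of steps, interval lengths
    (t₀ K : ℕ) (N : ℕ → ℕ) (hN : ∀ k, k ≤ K → N k < N (k + 1)) (ht₀ : N (K + 1) < t₀)
    (u₀ u : ℝ) (hMD : ConditionMD K N u₀ u)
    (Θ : Set ℝ) (a : ℝ) (hΘ : ConditionTheta Θ a)
    -- critical values calibrated by the propagation condition
    (r α : ℝ) (hr : 0 < r) (hα : 0 < α)
    (z : ℕ → ℝ) (hz : ∀ k, 1 ≤ k → k ≤ K → 0 ≤ z k)
    (θstar : ℝ) (hθstar : 0 < θstar) (hprop : Propagation t₀ K N z r α θstar)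
    -- small modeling bias up to step `kstar`
    (θ : ℝ) (hθ : θ ∈ Θ) (Δ : ℝ) (kstar : ℕ) (hk1 : 1 ≤ kstar) (hkK : kstar ≤ K)
    (hbias : ∀ k, 1 ≤ k → k ≤ kstar →
      Integrable (fun ω => modelingBias (fun t => σ t ω) t₀ N k θ) P ∧
        ∫ ω, modelingBias (fun t => σ t ω) t₀ N k θ ∂P ≤ Δ) :
    (Integrable (fun ω => Real.log (1 +
        |(N kstar : ℝ) * KL (localEst (fun t => R t ω) t₀ N kstar)
          (adaptEst (fun t => R t ω) t₀ N z kstar)| ^ r / (α * riskBound r))) P ∧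
      ∫ ω, Real.log (1 +
        |(N kstar : ℝ) * KL (localEst (fun t => R t ω) t₀ N kstar)
          (adaptEst (fun t => R t ω) t₀ N z kstar)| ^ r / (α * riskBound r)) ∂P ≤ 1 + Δ) ∧
    (∀ᵐ ω ∂P,
      (∀ k, kstar ≤ k → k ≤ K → adaptEst (fun t => R t ω) t₀ N z k ∈ Θ) →
        (N kstar : ℝ) * KL (adaptEst (fun t => R t ω) t₀ N z kstar)
            (adaptEst (fun t => R t ω) t₀ N z K)
          ≤ a ^ 2 * cConst u ^ 2 * maxCrit K z kstar) := by
  have hθ0 : 0 < θ := hΘ.1 hθ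
  have hNk : N (kstar + 1) < t₀ := (monotoneOn_lengths hN (by omega) le_rfl).trans_lt ht₀
  constructor
  · obtain ⟨hbi, hbΔ⟩ := hbias kstar hk1 le_rfl
    obtain ⟨hi, hle⟩ := hmodel.integral_log_one_add_le hθ0 (m := t₀ - N (kstar + 1)) (n := t₀)
      (by omega) (by omega) hbi (measurable_normLoss t₀ N z r α kstar)
      (normLoss_nonneg t₀ N z hr hα kstar) (fun x y hxy => normLoss_congr hN hkK hxy)
      (lintegral_normLoss_le hN ht₀ hr hα hθstar hprop hθ0 hk1 hkK)
    exact ⟨hi, hle.trans (add_le_add_right hbΔ 1)⟩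
  · filter_upwards [hmodel.ae_return_ne_zero] with ω hω hmem
    refine length_mul_KL_adaptEst_le hN ht₀ hMD hΘ hz hk1 hkK (fun t ht => hω t ?_) hmem
    have := (Finset.mem_Ico.1 ht).1
    omega
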